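/- Let $n\in\{2,3\}$, let $\mathbb{T}^n=(\mathbb{R}/2\pi\mathbb{Z})^n$, and let $\sigma>0$. Write $\hat f(k)$ for the Fourier coefficients of $f=\sum_{k\in\mathbb{Z}^n}\hat f(k)e^{ik\cdot x}$, let $(-\Delta)^{s}$ have symbol $|k|^{2s}$, and set $\|f\|_{\dot H^s}=\|(-\Delta)^{s/2}f\|_{L^2(\mathbb{T}^n)}$. Let $\mathring L^2(\mathbb{T}^n;\mathbb{R}^d)$ be the space of mean-zero fields in $L^2(\mathbb{T}^n;\mathbb{R}^d)$, and $L^2_\sigma$ the space of divergence-free fields in $\mathring L^2(\mathbb{T}^n;\mathbb{R}^n)$. For a bounded operator $G$ from a real Hilbert space into $\mathring L^2(\mathbb{T}^n;\mathbb{R}^d)$, a $GG^*$-Wiener process is a process $B$ with $B(0)=0$, with continuous trajectories in $L^2$ and independent increments, and such that $B(t)-B(s)$ has law $N(0,(t-s)GG^*)$ for $s\le t$. Consider, on a probability space $(\Omega,\mathcal{F},\mathbf{P})$, one of the equations $$dz+(-\Delta)^{\lambda}z\,dt+\nabla\pi\,dt=dB,\quad \nabla\cdot z=0,\quad z(0)=0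 \qquad (d=n),$$ or $$dz+(-\Delta)^{\lambda}z\,dt=dB,\quad z(0)=0\qquad (d\text{ arbitrary}),$$ where $B$ is a $GG^*$-Wiener process and $\lambda\in(0,\tfrac12+\tfrac n4)$. A solution is a process $z$ with values in $V=L^2_\sigma$, respectively $V=\mathring L^2(\mathbb{T}^n;\mathbb{R}^d)$, such that $z(0)=0$ almost surely and, for every smooth $\varphi\in V$, almost surely for all $t\ge 0$ the function $r\mapsto\langle z(r),(-\Delta)^\lambda\varphi\rangle$ is integrable on $[0,t]$ and $$\langle z(t),\varphi\rangle+\int_0^t\langle z(r),(-\Delta)^\lambda\varphi\rangle\,dr=\langle B(t),\varphi\rangle .$$ Suppose that $$\operatorname{Tr}\big((-\Delta)^{\max\{\frac n2+2\sigma,\ \frac{n+2}{2}-\lambda+2\sigma\}}GG^*\big)<\infty .$$ Then every solution $z$ satisfies, for all $\delta\in(0,\tfrac12)$, $T>0$ and $l\in\mathbb{N}$: almost surely $z\in C([0,T];\dot H^{\frac{2+n+\sigma}{2}})$, the two norms below are random variables, and $$\mathbb{E}^{\mathbf P}\Big[\|z\|^l_{C([0,T];\dot H^{\frac{2+n+\sigma}{2}})}+\|z\|^l_{C^{\frac12-\delta}([0,T];\dot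 H^{\frac{n+\sigma}{2}})}\Big]<\infty. \tag{$*$}$$ Consequently, let $m\in(0,1)$ if $n=2$ and $m\in(\tfrac{13}{20},\tfrac54)$ if $n=3$, let $G_1,G_2$ be bounded operators from real Hilbert spaces into $L^2_\sigma$ and $\mathring L^2(\mathbb{T}^n;\mathbb{R})$, respectively, with $$\operatorname{Tr}\big((-\Delta)^{\max\{\frac n2+2\sigma,\ \frac{n+2}{2}-m+2\sigma\}}G_1G_1^*\big)<\infty,\qquad \operatorname{Tr}\big((-\Delta)^{\frac n2+2\sigma}G_2G_2^*\big)<\infty,$$ and let $B_1,B_2$ be $G_1G_1^*$- and $G_2G_2^*$-Wiener processes. Then the solutions $z_1$ of $dz_1+(-\Delta)^m z_1\,dt+\nabla\pi_1\,dt=dB_1$, $\nabla\cdot z_1=0$, $z_1(0)=0$, and $z_2$ of $dz_2-\Delta z_2\,dt=dB_2$, $z_2(0)=0$, both satisfy $(*)$. -/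

import Mathlib

open MeasureTheory ProbabilityTheory Filter
open scoped NNReal ENNReal Topology

noncomputable section

/-! ### Vector fields on the torus `(ℝ / 2πℤ)ⁿ` -/

instance factTwoPiPos : Fact ((0 : ℝ) < 2 * Real.pi) := ⟨Real.two_pi_pos⟩

/-- The torus `𝕋ⁿ = (ℝ / 2πℤ)ⁿ`; its `volume` is Lebesgue measure, of total mass `(2π)ⁿ`. -/
abbrev Torus (n : ℕ) : Type := Fin n → AddCircle (2 * Real.pi)

/-- The real Hilbert space `L²(𝕋ⁿ; ℝᵈ)`. -/
abbrev L2Field (n d : ℕ) : Type := Lp (EuclideanSpace ℝ (Fin d)) 2 (volume : Measure (Torus n))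

instance L2Field.instMeasurableSpace (n d : ℕ) : MeasurableSpace (L2Field n d) := borel _

instance L2Field.instBorelSpace (n d : ℕ) : BorelSpace (L2Field n d) := ⟨rfl⟩

/-- The character `x ↦ exp (i k · x)` of the torus, `k ∈ ℤⁿ`. -/
def character {n : ℕ} (k : Fin n → ℤ) : C(Torus n, ℂ) where
  toFun x := ∏ i, fourier (k i) (x i)
  continuous_toFun := by fun_prop

/-- The `k`-th Fourier coefficient `(2π)⁻ⁿ ∫ f_c(x) exp (-i k · x) dx` of the `c`-th component
of `f`, so that `f_c = ∑ k, f̂_c(k) exp (i k · x)`. -/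
def fieldCoeff {n d : ℕ} (f : L2Field n d) (k : Fin n → ℤ) (c : Fin d) : ℂ :=
  ((2 * Real.pi : ℂ) ^ n)⁻¹ * ∫ x : Torus n, character (-k) x * ((f x c : ℝ) : ℂ)

/-- The field `x ↦ cos (k · x) e_c`. -/
def cosField {n d : ℕ} (k : Fin n → ℤ) (c : Fin d) : L2Field n d :=
  ContinuousMap.toLp 2 (volume : Measure (Torus n)) ℝ
    ⟨fun x => (character k x).re • EuclideanSpace.single c (1 : ℝ), by fun_prop⟩

/-- The field `x ↦ sin (k · x) e_c`. -/
def sinField {n d : ℕ} (k : Fin n → ℤ) (c : Fin d) : L2Field n d :=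
  ContinuousMap.toLp 2 (volume : Measure (Torus n)) ℝ
    ⟨fun x => (character k x).im • EuclideanSpace.single c (1 : ℝ), by fun_prop⟩

/-- `f` has mean zero; the fields with this property form `L̊²`. -/
def IsMeanZero {n d : ℕ} (f : L2Field n d) : Prop := ∀ c, fieldCoeff f 0 c = 0

/-- `f` has mean zero and `∇ · f = 0` in the sense of distributions, i.e. all Fourier coefficients
`i k · f̂(k)` of the divergence vanish; the fields with this property form `L²_σ`. -/
def IsSolenoidal {n : ℕ} (f : L2Field n n) : Prop :=
  IsMeanZero f ∧ ∀ k, ∑ c, (k c : ℂ) * fieldCoeff f k c = 0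

/-! ### Powers of the Laplacian and homogeneous Sobolev norms -/

/-- The symbol `|k|^{2 s}` of `(-Δ)^s`, where `|k|` is the Euclidean length of `k ∈ ℤⁿ`. -/
def fracSymbol {n : ℕ} (s : ℝ) (k : Fin n → ℤ) : ℝ := (∑ i, (k i : ℝ) ^ 2) ^ s

/-- `ψ = (-Δ)^s φ`. -/
def IsFracLaplacian {n d : ℕ} (s : ℝ) (φ ψ : L2Field n d) : Prop :=
  ∀ k c, fieldCoeff ψ k c = (fracSymbol s k : ℂ) * fieldCoeff φ k c

/-- `‖f‖_{Ḣ^s} = ‖(-Δ)^{s/2} f‖_{L²} = ((2π)ⁿ ∑ k, |k|^{2 s} |f̂(k)|²)^{1/2} ∈ [0, ∞]` for a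
field `f` of mean zero. -/
def hdotNorm {n d : ℕ} (s : ℝ) (f : L2Field n d) : ℝ≥0∞ :=
  (ENNReal.ofReal ((2 * Real.pi) ^ n) *
    ∑' k : Fin n → ℤ, ENNReal.ofReal (fracSymbol s k) * ∑ c, ‖fieldCoeff f k c‖ₑ ^ 2) ^ (1 / 2 : ℝ)

/-- `f`, of mean zero, is smooth: it lies in `Ḣ^s` for every `s`. -/
def IsSmoothField {n d : ℕ} (f : L2Field n d) : Prop := ∀ s : ℝ, hdotNorm s f < ∞

/-- `Tr ((-Δ)^s Q) = ∑ ⟨Q e, (-Δ)^s e⟩ ∈ [0, ∞]`, for a positive operator `Q` and `s > 0`, computed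
in the eigenfunctions of the Laplacian: the sum of `|k|^{2 s} ⟨Q e, e⟩` over
`e = (2π)^{-n/2} exp (i k · x) e_c`, where
`⟨Q e, e⟩ = (2π)⁻ⁿ (⟨Q cos (k · x) e_c, cos (k · x) e_c⟩ + ⟨Q sin (k · x) e_c, sin (k · x) e_c⟩)`
by complexification. -/
def traceFracLaplacian {n d : ℕ} (s : ℝ) (Q : L2Field n d →L[ℝ] L2Field n d) : ℝ≥0∞ :=
  ∑' k : Fin n → ℤ, ∑ c : Fin d, ENNReal.ofReal (fracSymbol s k *
    (((2 * Real.pi) ^ n)⁻¹ * (inner ℝ (Q (cosField k c)) (cosField k c) +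
      inner ℝ (Q (sinField k c)) (sinField k c))))

/-! ### Wiener processes and linear stochastic equations -/

/-- The operator `G G*`. -/
def covOp {U : Type*} [NormedAddCommGroup U] [InnerProductSpace ℝ U] [CompleteSpace U] {n d : ℕ}
    (G : U →L[ℝ] L2Field n d) : L2Field n d →L[ℝ] L2Field n d :=
  G.comp (ContinuousLinearMap.adjoint G)

/-- `B` is a `Q`-Wiener process in `L²(𝕋ⁿ; ℝᵈ)`: it starts at `0`, has continuous trajectories and
independent increments, and `B t - B s` has law `N(0, (t - s) Q)` for `s ≤ t`. -/
structure IsWienerProcess {Ω : Type*} [MeasurableSpace Ω] (P : Measure Ω) {n d : ℕ}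
    (Q : L2Field n d →L[ℝ] L2Field n d) (B : ℝ≥0 → Ω → L2Field n d) : Prop where
  measurable : ∀ t, AEMeasurable (B t) P
  zero : ∀ᵐ ω ∂P, B 0 ω = 0
  continuous : ∀ᵐ ω ∂P, Continuous fun t => B t ω
  indep : HasIndepIncrements B P
  gaussian : ∀ s t : ℝ≥0, s ≤ t → ∀ φ : L2Field n d,
    P.map (fun ω => inner ℝ (B t ω - B s ω) φ) =
      gaussianReal 0 ((t - s) * (inner ℝ (Q φ) φ).toNNReal)

/-- `z` is a weak solution, in the space of the fields satisfying `V`, of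
`dz + (-Δ)^lam z dt = dB`, `z(0) = 0`: it takes values in that space, and for every smooth field
`φ` in that space `⟨z(t), φ⟩ - ⟨z(0), φ⟩ + ∫₀ᵗ ⟨z(r), (-Δ)^lam φ⟩ dr = ⟨B(t), φ⟩` for all `t ≥ 0`,
almost surely. -/
structure IsWeakSolution {Ω : Type*} [MeasurableSpace Ω] (P : Measure Ω) {n d : ℕ}
    (V : L2Field n d → Prop) (lam : ℝ) (B z : ℝ≥0 → Ω → L2Field n d) : Prop where
  mem : ∀ᵐ ω ∂P, ∀ t, V (z t ω)
  init : ∀ᵐ ω ∂P, z 0 ω = 0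
  weak : ∀ φ ψ : L2Field n d, V φ → IsSmoothField φ → IsFracLaplacian lam φ ψ →
    ∀ᵐ ω ∂P, ∀ t : ℝ≥0,
      IntervalIntegrable (fun r : ℝ => inner ℝ (z r.toNNReal ω) ψ) volume 0 t ∧
      inner ℝ (z t ω) φ - inner ℝ (z 0 ω) φ + ∫ r in (0 : ℝ)..t, inner ℝ (z r.toNNReal ω) ψ =
        inner ℝ (B t ω) φ

/-- `z` solves `dz + (-Δ)^lam z dt = dB`, `z(0) = 0`, among the fields of mean zero. -/
def IsHeatSolution {Ω : Type*} [MeasurableSpace Ω] (P : Measure Ω) {n d : ℕ} (lam : ℝ)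
    (B z : ℝ≥0 → Ω → L2Field n d) : Prop :=
  IsWeakSolution P IsMeanZero lam B z

/-- `z` solves `dz + (-Δ)^lam z dt + ∇π dt = dB`, `∇ · z = 0`, `z(0) = 0`, among the fields of mean
zero; solenoidal test fields eliminate the pressure `π`. -/
def IsStokesSolution {Ω : Type*} [MeasurableSpace Ω] (P : Measure Ω) {n : ℕ} (lam : ℝ)
    (B z : ℝ≥0 → Ω → L2Field n n) : Prop :=
  IsWeakSolution P IsSolenoidal lam B z

/-! ### Norms of trajectories on `[0, T]` -/

/-- The trajectory `f` lies in `C([0, T]; Ḣ^s)`. -/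
def IsContinuousHdot {n d : ℕ} (T : ℝ≥0) (s : ℝ) (f : ℝ≥0 → L2Field n d) : Prop :=
  ∀ t ≤ T, hdotNorm s (f t) < ∞ ∧
    Tendsto (fun r => hdotNorm s (f r - f t)) (𝓝[Set.Iic T] t) (𝓝 0)

/-- The norm of `C([0, T]; Ḣ^s)`. -/
def supHdotNorm {n d : ℕ} (T : ℝ≥0) (s : ℝ) (f : ℝ≥0 → L2Field n d) : ℝ≥0∞ :=
  ⨆ t ∈ Set.Iic T, hdotNorm s (f t)

/-- The norm of the Hölder space `C^γ([0, T]; Ḣ^s)`. -/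
def holderHdotNorm {n d : ℕ} (T : ℝ≥0) (γ s : ℝ) (f : ℝ≥0 → L2Field n d) : ℝ≥0∞ :=
  supHdotNorm T s f +
    ⨆ r ∈ Set.Iic T, ⨆ t ∈ Set.Iic T, ⨆ _ : r ≠ t, hdotNorm s (f t - f r) / edist t r ^ γ

/-- For all `δ ∈ (0, 1/2)`, `T > 0` and `l ∈ ℕ`, almost every trajectory of `z` lies in
`C([0, T]; Ḣ^{(2+n+σ)/2})`, and
`E [‖z‖^l_{C_T Ḣ^{(2+n+σ)/2}} + ‖z‖^l_{C_T^{1/2-δ} Ḣ^{(n+σ)/2}}] < ∞`,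
both norms being random variables. -/
def HasRegularityMoments {Ω : Type*} [MeasurableSpace Ω] (P : Measure Ω) {n d : ℕ} (σ : ℝ)
    (z : ℝ≥0 → Ω → L2Field n d) : Prop :=
  ∀ δ : ℝ, 0 < δ → δ < 1 / 2 → ∀ T : ℝ≥0, 0 < T → ∀ l : ℕ,
    (∀ᵐ ω ∂P, IsContinuousHdot T ((2 + n + σ) / 2) fun t => z t ω) ∧
    AEMeasurable (fun ω => supHdotNorm T ((2 + n + σ) / 2) fun t => z t ω) P ∧
    AEMeasurable (fun ω => holderHdotNorm T (1 / 2 - δ) ((n + σ) / 2) fun t => z t ω) P ∧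
    ∫⁻ ω, ((supHdotNorm T ((2 + n + σ) / 2) fun t => z t ω) ^ l +
      (holderHdotNorm T (1 / 2 - δ) ((n + σ) / 2) fun t => z t ω) ^ l) ∂P < ∞

end

/-!
In the real Fourier modes `cos (k · x) e_c` and `sin (k · x) e_c` a solution is a family of scalar
Ornstein–Uhlenbeck processes `X` of rates `a = |k|^{2λ}`, driven by real Brownian motions. For the
equation with pressure one tests with the plane waves whose polarization is the projection of `e_c`
to the orthogonal complement of `k`, which a solenoidal field does not distinguish from `e_c`.

Since `X t` is the mean of `β t - β (t - r)` over an exponentially distributed `r`, a bound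
`|β t - β s| ≤ H |t - s|^γ` gives `|X t| ≤ C a^{-γ} H` and `|X t - X s| ≤ 2 H |t - s|^γ`. The first
estimate, with `γ < 1/2` close to `1/2`, gains almost `λ` derivatives over the noise; the second one
gains none, but is Hölder in time. By chaining along dyadic times the moments of `H` are bounded by
powers of the variance of `β 1`, and Minkowski's inequality in `L^{q/2}` sums the squares over the
modes. The correlations between the modes never matter.
-/

noncomputable section

/-! ### Ornstein–Uhlenbeck paths -/

theorem integrable_comp_tsub {E : Type*} [NormedAddCommGroup E] {b : ℝ≥0 → E} (μ : Measure ℝ)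
    [IsFiniteMeasure μ] (hb : Continuous b) (t : ℝ≥0) :
    Integrable (fun r : ℝ ↦ b (t - r.toNNReal)) μ := by
  obtain ⟨C, hC⟩ := (isCompact_Icc (a := 0) (b := t)).exists_bound_of_continuousOn hb.continuousOn
  exact .of_bound (by fun_prop) C <| ae_of_all _ fun r ↦ hC _ ⟨zero_le, tsub_le_self⟩

theorem edist_tsub_tsub_le (s t u : ℝ≥0) : edist (t - u) (s - u) ≤ edist t s := by
  simp only [edist_nndist, NNReal.nndist_eq, ENNReal.coe_le_coe]
  exact max_le_max (tsub_le_iff_right.2 tsub_le_tsub_add_tsub)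
    (tsub_le_iff_right.2 tsub_le_tsub_add_tsub)

theorem edist_self_tsub_le (t u : ℝ≥0) : edist t (t - u) ≤ u := by
  rw [edist_nndist, NNReal.nndist_eq, tsub_eq_zero_of_le tsub_le_self, ENNReal.coe_le_coe]
  exact max_le tsub_tsub_le zero_le

section OrnsteinUhlenbeck

variable {E : Type*} [NormedAddCommGroup E] [NormedSpace ℝ E] {a : ℝ} {b : ℝ≥0 → E}

/-- The Ornstein–Uhlenbeck path with rate `a` driven by the path `b`, i.e. the solution of
`X t + a ∫₀ᵗ X = b t` when `b 0 = 0`. The subtraction of times is truncated at `0`, where `b`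
vanishes, so that the exponential law may be integrated over the whole half-line. -/
def ouPath (a : ℝ) (b : ℝ≥0 → E) (t : ℝ≥0) : E :=
  b t - ∫ r, b (t - r.toNNReal) ∂expMeasure a

theorem exp_smul_primitive_eq {X : ℝ → E} [CompleteSpace E] (hb : Continuous b)
    (hX : ∀ t : ℝ≥0, IntervalIntegrable X volume 0 t ∧ X t + a • ∫ r in (0 : ℝ)..t, X r = b t)
    (t : ℝ≥0) :
    Real.exp (a * t) • ∫ r in (0 : ℝ)..t, X r =
      ∫ s in (0 : ℝ)..t, Real.exp (a * s) • b s.toNNReal := by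
  set F : ℝ → E := fun t ↦ ∫ r in (0 : ℝ)..t, X r with hF
  have hX_eq : ∀ s, 0 ≤ s → X s = b s.toNNReal - a • F s := fun s hs ↦ by
    have := (hX s.toNNReal).2
    rw [Real.coe_toNNReal s hs] at this
    rw [← this, add_sub_cancel_right]
  have hint : ∀ s, 0 ≤ s → IntervalIntegrable X volume 0 s := fun s hs ↦ (hX ⟨s, hs⟩).1
  have hF_cont : ContinuousOn F (Set.Icc 0 (t + 1)) := by
    have ht : (0 : ℝ) ≤ t + 1 := by positivity
    simpa only [Set.uIcc_of_le ht] using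
      intervalIntegral.continuousOn_primitive_interval' (hint _ ht) Set.left_mem_uIcc
  have hX_cont : ContinuousOn X (Set.Ioo 0 (t + 1)) :=
    ((by fun_prop : Continuous fun s : ℝ ↦ b s.toNNReal).continuousOn.sub
      ((hF_cont.mono Set.Ioo_subset_Icc_self).const_smul a)).congr fun s hs ↦ hX_eq s hs.1.le
  have hF_deriv : ∀ s ∈ Set.Ioo (0 : ℝ) t, HasDerivAt F (X s) s := fun s hs ↦
    have hs' : s ∈ Set.Ioo (0 : ℝ) (t + 1) := ⟨hs.1, by linarith [hs.2]⟩
    intervalIntegral.integral_hasDerivAt_right (hint s hs.1.le)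
      (hX_cont.stronglyMeasurableAtFilter isOpen_Ioo s hs')
      (hX_cont.continuousAt (isOpen_Ioo.mem_nhds hs'))
  symm
  rw [intervalIntegral.integral_eq_sub_of_hasDerivAt_of_le
    (f := fun s ↦ Real.exp (a * s) • F s) (f' := fun s ↦ Real.exp (a * s) • b s.toNNReal)
    t.coe_nonneg]
  · simp [hF]
  · exact (by fun_prop : Continuous fun s ↦ Real.exp (a * s)).continuousOn.smul
      (hF_cont.mono (Set.Icc_subset_Icc_right (by linarith)))
  · intro s hs
    have hexp : HasDerivAt (fun s ↦ Real.exp (a * s)) (Real.exp (a * s) * a) s := by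
      simpa using ((hasDerivAt_id s).const_mul a).exp
    refine (hexp.smul (hF_deriv s hs)).congr_deriv ?_
    rw [hX_eq s hs.1.le, smul_sub, mul_smul, sub_add_cancel]
  · exact Continuous.intervalIntegrable (by fun_prop) _ _

theorem expMeasure_eq_withDensity (a : ℝ) :
    expMeasure a = (volume.restrict (Set.Ioi 0)).withDensity
      fun r ↦ ENNReal.ofReal (a * Real.exp (-(a * r))) := by
  have hpdf : gammaPDF 1 a =
      (Set.Ici 0).indicator fun r ↦ ENNReal.ofReal (a * Real.exp (-(a * r))) := by
    ext r
    rw [show gammaPDF 1 a r = exponentialPDF a r from rfl, exponentialPDF_eq, Set.indicator_apply]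
    simp only [Set.mem_Ici, apply_ite ENNReal.ofReal, ENNReal.ofReal_zero]
  rw [expMeasure, gammaMeasure, hpdf, withDensity_indicator measurableSet_Ici,
    restrict_Ioi_eq_restrict_Ici]

theorem integral_expMeasure (ha : 0 < a) (f : ℝ → E) :
    ∫ r, f r ∂expMeasure a = ∫ r in Set.Ioi 0, (a * Real.exp (-(a * r))) • f r := by
  rw [expMeasure_eq_withDensity a, integral_withDensity_eq_integral_toReal_smul (by fun_prop)
    (ae_of_all _ fun r ↦ ENNReal.ofReal_lt_top)]
  refine integral_congr_ae (ae_of_all _ fun r ↦ ?_)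
  simp only [ENNReal.toReal_ofReal (by positivity : 0 ≤ a * Real.exp (-(a * r)))]

theorem lintegral_rpow_expMeasure {γ : ℝ} (ha : 0 < a) (hγ : -1 < γ) :
    ∫⁻ r, ENNReal.ofReal r ^ γ ∂expMeasure a =
      ENNReal.ofReal (Real.Gamma (γ + 1) * a ^ (-γ)) := by
  have hint : ∫ r in Set.Ioi 0, a * (r ^ γ * Real.exp (-(a * r))) =
      Real.Gamma (γ + 1) * a ^ (-γ) := by
    have h := Real.integral_rpow_mul_exp_neg_mul_Ioi (by linarith : 0 < γ + 1) ha
    rw [add_sub_cancel_right] at h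
    rw [integral_const_mul, h, one_div, Real.inv_rpow ha.le, ← Real.rpow_neg ha.le, neg_add,
      Real.rpow_add ha, Real.rpow_neg_one]
    field_simp
  rw [expMeasure_eq_withDensity a, lintegral_withDensity_eq_lintegral_mul₀ (by fun_prop)
    (by fun_prop), ← hint, ofReal_integral_eq_lintegral_ofReal]
  · refine setLIntegral_congr_fun measurableSet_Ioi fun r (hr : 0 < r) ↦ ?_
    rw [Pi.mul_apply, ENNReal.ofReal_rpow_of_pos hr, ← ENNReal.ofReal_mul (by positivity)]
    ring_nf
  · by_contra h
    rw [integral_undef h] at hint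
    have := Real.Gamma_pos_of_pos (by linarith : 0 < γ + 1)
    exact absurd hint (by positivity)
  · filter_upwards [ae_restrict_mem measurableSet_Ioi] with r (hr : 0 < r)
    positivity

theorem integral_expMeasure_comp_sub (ha : 0 < a) (hb0 : b 0 = 0) (t : ℝ≥0) :
    ∫ r, b (t - r.toNNReal) ∂expMeasure a =
      a • Real.exp (-(a * t)) • ∫ s in (0 : ℝ)..t, Real.exp (a * s) • b s.toNNReal := by
  have htail : ∀ r ∉ Set.Ioc (0 : ℝ) t, r ∈ Set.Ioi 0 →
      (a * Real.exp (-(a * r))) • b (t - r.toNNReal) = 0 := fun r hr hr0 ↦ by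
    have : t ≤ r.toNNReal := NNReal.le_toNNReal_of_coe_le (not_le.1 fun h ↦ hr ⟨hr0, h⟩).le
    rw [tsub_eq_zero_of_le this, hb0, smul_zero]
  calc ∫ r, b (t - r.toNNReal) ∂expMeasure a
      = ∫ r in (0 : ℝ)..t, (a * Real.exp (-(a * r))) • b (t - r.toNNReal) := by
        rw [integral_expMeasure ha, intervalIntegral.integral_of_le t.coe_nonneg]
        exact setIntegral_eq_of_subset_of_forall_sdiff_eq_zero measurableSet_Ioi
          Set.Ioc_subset_Ioi_self fun r hr ↦ htail r hr.2 hr.1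
    _ = ∫ s in (0 : ℝ)..t, (a * Real.exp (-(a * (t - s)))) • b (t - (t - s).toNNReal) := by
        simp [intervalIntegral.integral_comp_sub_left
          (fun r ↦ (a * Real.exp (-(a * r))) • b (t - r.toNNReal)) (t : ℝ)]
    _ = ∫ s in (0 : ℝ)..t, a • Real.exp (-(a * t)) • Real.exp (a * s) • b s.toNNReal := by
        refine intervalIntegral.integral_congr fun s hs ↦ ?_
        rw [Set.uIcc_of_le t.coe_nonneg] at hs
        have ht : t - ((t : ℝ) - s).toNNReal = s.toNNReal := by
          rw [← NNReal.coe_inj,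
            NNReal.coe_sub (Real.toNNReal_le_iff_le_coe.2 (sub_le_self _ hs.1)),
            Real.coe_toNNReal _ hs.1, Real.coe_toNNReal _ (sub_nonneg.2 hs.2), sub_sub_cancel]
        simp only [ht]
        rw [smul_smul (Real.exp _), ← Real.exp_add, smul_smul]
        ring_nf
    _ = _ := by simp only [intervalIntegral.integral_smul]

theorem eq_ouPath [CompleteSpace E] {X : ℝ≥0 → E} (ha : 0 < a) (hb : Continuous b) (hb0 : b 0 = 0)
    (hX : ∀ t : ℝ≥0, IntervalIntegrable (fun r ↦ X r.toNNReal) volume 0 t ∧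
      X t + a • ∫ r in (0 : ℝ)..t, X r.toNNReal = b t) (t : ℝ≥0) : X t = ouPath a b t := by
  have h := exp_smul_primitive_eq (X := fun r ↦ X r.toNNReal) hb (fun t ↦ by simpa using hX t) t
  rw [ouPath, integral_expMeasure_comp_sub ha hb0, ← h, smul_smul (Real.exp _), ← Real.exp_add,
    neg_add_cancel, Real.exp_zero, one_smul, ← (hX t).2, add_sub_cancel_right]

theorem continuous_ouPath (ha : 0 < a) (hb : Continuous b) : Continuous (ouPath a b) := by
  have := isProbabilityMeasure_expMeasure ha
  refine hb.sub (continuous_iff_continuousAt.2 fun t ↦ ?_)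
  obtain ⟨C, hC⟩ :=
    (isCompact_Icc (a := 0) (b := t + 1)).exists_bound_of_continuousOn hb.continuousOn
  refine continuousAt_of_dominated (.of_forall fun u ↦ by fun_prop) ?_ (integrable_const C)
    (ae_of_all _ fun r ↦ by fun_prop)
  filter_upwards [Iic_mem_nhds (lt_add_one t)] with u hu
  exact ae_of_all _ fun r ↦ hC _ ⟨zero_le, tsub_le_self.trans hu⟩

theorem ouPath_eq_integral [CompleteSpace E] (ha : 0 < a) (hb : Continuous b) (t : ℝ≥0) :
    ouPath a b t = ∫ r, (b t - b (t - r.toNNReal)) ∂expMeasure a := by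
  have := isProbabilityMeasure_expMeasure ha
  rw [integral_sub (integrable_const _) (integrable_comp_tsub _ hb t), integral_const]
  simp [ouPath]

variable {T : ℝ≥0} {γ : ℝ} {H : ℝ≥0∞}

theorem enorm_ouPath_le [CompleteSpace E] (ha : 0 < a) (hb : Continuous b) (hγ : 0 ≤ γ)
    (hH : ∀ s ≤ T, ∀ t ≤ T, edist (b t) (b s) ≤ H * edist t s ^ γ) {t : ℝ≥0} (ht : t ≤ T) :
    ‖ouPath a b t‖ₑ ≤ H * ENNReal.ofReal (Real.Gamma (γ + 1) * a ^ (-γ)) := by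
  have hbound : ∀ᵐ r ∂expMeasure a,
      ‖b t - b (t - r.toNNReal)‖ₑ ≤ H * ENNReal.ofReal r ^ γ := by
    filter_upwards with r
    have hdist : edist t (t - r.toNNReal) ≤ ENNReal.ofReal r := edist_self_tsub_le t _
    rw [← edist_eq_enorm_sub]
    refine (hH _ (tsub_le_self.trans ht) t ht).trans ?_
    gcongr
  rw [ouPath_eq_integral ha hb, ← lintegral_rpow_expMeasure ha (by linarith),
    ← lintegral_const_mul _ (by fun_prop)]
  exact (enorm_integral_le_lintegral_enorm _).trans (lintegral_mono_ae hbound)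

theorem edist_ouPath_le (ha : 0 < a) (hb : Continuous b) (hγ : 0 ≤ γ)
    (hH : ∀ s ≤ T, ∀ t ≤ T, edist (b t) (b s) ≤ H * edist t s ^ γ) {s t : ℝ≥0} (hs : s ≤ T)
    (ht : t ≤ T) :
    edist (ouPath a b t) (ouPath a b s) ≤ 2 * (H * edist t s ^ γ) := by
  have := isProbabilityMeasure_expMeasure ha
  have hbound : ∀ r : ℝ, ‖b (t - r.toNNReal) - b (s - r.toNNReal)‖ₑ ≤ H * edist t s ^ γ := by
    intro r
    have hdist := edist_tsub_tsub_le s t r.toNNReal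
    rw [← edist_eq_enorm_sub]
    refine (hH _ (tsub_le_self.trans hs) _ (tsub_le_self.trans ht)).trans ?_
    gcongr
  have hsub : ouPath a b t - ouPath a b s =
      (b t - b s) - ∫ r, (b (t - r.toNNReal) - b (s - r.toNNReal)) ∂expMeasure a := by
    rw [integral_sub (integrable_comp_tsub _ hb t) (integrable_comp_tsub _ hb s), ouPath, ouPath]
    abel
  rw [edist_eq_enorm_sub, hsub, two_mul]
  refine (enorm_sub_le).trans (add_le_add ?_ ?_)
  · exact (edist_eq_enorm_sub _ _).symm.trans_le (hH s hs t ht)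
  · refine (enorm_integral_le_lintegral_enorm _).trans
      ((lintegral_mono hbound).trans_eq ?_)
    rw [lintegral_const, measure_univ, mul_one]

end OrnsteinUhlenbeck

theorem tendsto_floor_mul_div (t : ℝ≥0) :
    Tendsto (fun m : ℕ ↦ (⌊t * m⌋₊ : ℝ≥0) / m) atTop (𝓝 t) := by
  have hfloor : ∀ m : ℕ, ⌊t * m⌋₊ = ⌊(t : ℝ) * m⌋₊ := fun m ↦ by
    rw [← NNReal.coe_natCast m, ← NNReal.coe_mul]
    exact (Nonneg.nat_floor_coe (t * m : ℝ≥0)).symm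
  rw [← NNReal.tendsto_coe]
  simpa only [Function.comp_def, NNReal.coe_div, NNReal.coe_natCast, hfloor] using
    (tendsto_nat_floor_mul_div_atTop t.coe_nonneg).comp tendsto_natCast_atTop_atTop

section Measurability

variable {Ω E : Type*} [MeasurableSpace Ω] {P : Measure Ω} [MeasurableSpace E] {β : ℝ≥0 → Ω → E}

theorem aemeasurable_uncurry_of_ae_continuous [TopologicalSpace E]
    [TopologicalSpace.PseudoMetrizableSpace E] [BorelSpace E] {α : Type*} [MeasurableSpace α]
    {ν : Measure α} (hm : ∀ t, AEMeasurable (β t) P)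
    (hc : ∀ᵐ ω ∂P, Continuous fun t ↦ β t ω) {τ : α → ℝ≥0} (hτ : Measurable τ) :
    AEMeasurable (fun p : Ω × α ↦ β (τ p.2) p.1) (P.prod ν) := by
  have happrox : ∀ m : ℕ, AEMeasurable (fun p : Ω × α ↦ β (⌊τ p.2 * m⌋₊ / m) p.1) (P.prod ν) := by
    intro m
    have hfloor : Measurable fun p : Ω × α ↦ (p.1, ⌊τ p.2 * m⌋₊) :=
      measurable_fst.prodMk (Nat.measurable_floor.comp ((hτ.comp measurable_snd).mul_const _))
    have hmk : Measurable fun p : Ω × ℕ ↦ (hm (p.2 / m)).mk _ p.1 :=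
      measurable_from_prod_countable_left fun j ↦ (hm (j / m)).measurable_mk
    have hmk_eq : ∀ᵐ ω ∂P, ∀ j : ℕ, β (j / m) ω = (hm (j / m)).mk _ ω :=
      ae_all_iff.2 fun j ↦ (hm (j / m)).ae_eq_mk
    refine ⟨_, hmk.comp hfloor, ?_⟩
    filter_upwards [Measure.quasiMeasurePreserving_fst.ae hmk_eq] with p hp
    exact hp ⌊τ p.2 * m⌋₊
  refine aemeasurable_of_tendsto_metrizable_ae atTop happrox ?_
  filter_upwards [Measure.quasiMeasurePreserving_fst.ae hc] with p hp
  exact (hp.tendsto _).comp (tendsto_floor_mul_div _)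

theorem aemeasurable_ouPath [NormedAddCommGroup E] [NormedSpace ℝ E] [BorelSpace E]
    [SecondCountableTopology E] {a : ℝ} (ha : 0 < a) (hm : ∀ t, AEMeasurable (β t) P)
    (hc : ∀ᵐ ω ∂P, Continuous fun t ↦ β t ω) (t : ℝ≥0) :
    AEMeasurable (fun ω ↦ ouPath a (fun s ↦ β s ω) t) P := by
  have := isProbabilityMeasure_expMeasure ha
  have hjoint : AEMeasurable (fun p : Ω × ℝ ↦ β (t - p.2.toNNReal) p.1)
      (P.prod (expMeasure a)) :=
    aemeasurable_uncurry_of_ae_continuous hm hc (τ := fun r : ℝ ↦ t - r.toNNReal) (by fun_prop)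
  exact (hm t).sub hjoint.aestronglyMeasurable.integral_prod_right'.aemeasurable

end Measurability

/-! ### Chaining along dyadic times -/

/-- The largest multiple of `2⁻ᵐ` which is at most `t`. -/
def dyadicFloor (m : ℕ) (t : ℝ≥0) : ℝ≥0 := (⌊t * 2 ^ m⌋₊ : ℝ≥0) / 2 ^ m

theorem tendsto_dyadicFloor (t : ℝ≥0) : Tendsto (fun m ↦ dyadicFloor m t) atTop (𝓝 t) := by
  simpa only [Function.comp_def, dyadicFloor, Nat.cast_pow, Nat.cast_ofNat] using
    (tendsto_floor_mul_div t).comp (tendsto_pow_atTop_atTop_of_one_lt one_lt_two)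

theorem floor_mul_two_pow_le {t : ℝ≥0} (ht : t ≤ 1) (m : ℕ) : ⌊t * 2 ^ m⌋₊ ≤ 2 ^ m := by
  refine Nat.floor_le_of_le ?_
  push_cast
  exact mul_le_of_le_one_left zero_le ht

theorem floor_mul_two_pow_succ (t : ℝ≥0) (m : ℕ) :
    ⌊t * 2 ^ (m + 1)⌋₊ = 2 * ⌊t * 2 ^ m⌋₊ ∨ ⌊t * 2 ^ (m + 1)⌋₊ = 2 * ⌊t * 2 ^ m⌋₊ + 1 := by
  have h : ⌊t * 2 ^ m⌋₊ = ⌊t * 2 ^ (m + 1)⌋₊ / 2 := by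
    rw [← Nat.floor_div_ofNat, pow_succ, ← mul_assoc, mul_div_cancel_right₀ _ two_ne_zero]
  omega

section Chaining

variable {E : Type*} [PseudoEMetricSpace E] {g : ℝ≥0 → E} {A ρ : ℝ≥0∞} {s t : ℝ≥0}

theorem edist_dyadic_le_of_le_succ
    (hA : ∀ m j : ℕ, j < 2 ^ m → edist (g (j / 2 ^ m)) (g ((j + 1) / 2 ^ m)) ≤ A * ρ ^ m)
    {m i j : ℕ} (hij : i ≤ j) (hji : j ≤ i + 1) (hj : j ≤ 2 ^ m) :
    edist (g (i / 2 ^ m)) (g (j / 2 ^ m)) ≤ A * ρ ^ m := by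
  obtain rfl | rfl : j = i ∨ j = i + 1 := by omega
  · simp
  · exact_mod_cast hA m i hj

theorem edist_dyadicFloor_succ_le
    (hA : ∀ m j : ℕ, j < 2 ^ m → edist (g (j / 2 ^ m)) (g ((j + 1) / 2 ^ m)) ≤ A * ρ ^ m)
    (ht : t ≤ 1) (m : ℕ) :
    edist (g (dyadicFloor m t)) (g (dyadicFloor (m + 1) t)) ≤ A * ρ * ρ ^ m := by
  have hfloor : dyadicFloor m t = (2 * ⌊t * 2 ^ m⌋₊ : ℕ) / 2 ^ (m + 1) := by
    rw [dyadicFloor, pow_succ', Nat.cast_mul, Nat.cast_ofNat, mul_div_mul_left _ _ two_ne_zero]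
  rw [hfloor, mul_assoc, ← pow_succ']
  have := floor_mul_two_pow_succ t m
  exact edist_dyadic_le_of_le_succ hA (by omega) (by omega) (floor_mul_two_pow_le ht _)

theorem edist_dyadicFloor_le (hg : Continuous g)
    (hA : ∀ m j : ℕ, j < 2 ^ m → edist (g (j / 2 ^ m)) (g ((j + 1) / 2 ^ m)) ≤ A * ρ ^ m)
    (ht : t ≤ 1) (m : ℕ) :
    edist (g (dyadicFloor m t)) (g t) ≤ A * ρ * ρ ^ m / (1 - ρ) :=
  edist_le_of_edist_le_geometric_of_tendsto ρ (A * ρ) (edist_dyadicFloor_succ_le hA ht)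
    ((hg.tendsto t).comp (tendsto_dyadicFloor t)) m

theorem edist_dyadicFloor_dyadicFloor_le
    (hA : ∀ m j : ℕ, j < 2 ^ m → edist (g (j / 2 ^ m)) (g ((j + 1) / 2 ^ m)) ≤ A * ρ ^ m)
    (hst : s ≤ t) (ht : t ≤ 1) {m : ℕ} (hm : t - s ≤ (2 ^ m)⁻¹) :
    edist (g (dyadicFloor m s)) (g (dyadicFloor m t)) ≤ A * ρ ^ m := by
  refine edist_dyadic_le_of_le_succ hA (Nat.floor_mono (by gcongr)) ?_ (floor_mul_two_pow_le ht m)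
  rw [← Nat.floor_add_one zero_le]
  refine Nat.floor_mono ?_
  calc t * 2 ^ m ≤ (s + (2 ^ m)⁻¹) * 2 ^ m := by gcongr; exact tsub_le_iff_left.1 hm
    _ = s * 2 ^ m + 1 := by rw [add_mul, inv_mul_cancel₀ (by positivity)]

theorem two_rpow_neg_pow_le {γ : ℝ} (hγ : 0 ≤ γ) {m : ℕ} {δ : ℝ≥0∞} (h : 2⁻¹ ^ (m + 1) ≤ δ) :
    ((2 : ℝ≥0∞) ^ (-γ)) ^ m ≤ 2 ^ γ * δ ^ γ :=
  calc ((2 : ℝ≥0∞) ^ (-γ)) ^ m = 2 ^ γ * (2⁻¹ ^ (m + 1)) ^ γ := by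
        rw [← ENNReal.inv_pow, ← ENNReal.rpow_natCast, ← ENNReal.rpow_natCast, ← ENNReal.rpow_neg,
          ← ENNReal.rpow_mul, ← ENNReal.rpow_mul,
          ← ENNReal.rpow_add _ _ two_ne_zero ENNReal.ofNat_ne_top]
        push_cast
        ring_nf
    _ ≤ 2 ^ γ * δ ^ γ := by gcongr

theorem edist_le_of_dyadic_of_le_one {γ : ℝ} (hγ : 0 < γ) (hg : Continuous g)
    (hA : ∀ m j : ℕ, j < 2 ^ m →
      edist (g (j / 2 ^ m)) (g ((j + 1) / 2 ^ m)) ≤ A * ((2 : ℝ≥0∞) ^ (-γ)) ^ m)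
    (hs : s ≤ 1) (ht : t ≤ 1) :
    edist (g s) (g t) ≤ 3 * (1 - (2 : ℝ≥0∞) ^ (-γ))⁻¹ * 2 ^ γ * A * edist s t ^ γ := by
  wlog hst : s < t generalizing s t
  · rcases (not_lt.1 hst).eq_or_lt with rfl | hts
    · simp
    · simpa only [edist_comm] using this ht hs hts
  set ρ : ℝ≥0∞ := 2 ^ (-γ)
  have hρ : ρ ≤ 1 := ENNReal.rpow_le_one_of_one_le_of_neg one_le_two (by linarith)
  obtain ⟨m, hm_lt, hm_le⟩ := exists_nat_pow_near_of_lt_one (tsub_pos_of_lt hst)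
    (tsub_le_self.trans ht)
    (by positivity : (0 : ℝ≥0) < 2⁻¹) (inv_lt_one_of_one_lt₀ one_lt_two)
  have hdist : (2⁻¹ : ℝ≥0∞) ^ (m + 1) ≤ edist s t := by
    have h : (2⁻¹ : ℝ≥0) ^ (m + 1) ≤ max (s - t) (t - s) := hm_lt.le.trans (le_max_right _ _)
    rw [edist_nndist, NNReal.nndist_eq, ← ENNReal.coe_ofNat, ← ENNReal.coe_inv two_ne_zero]
    exact_mod_cast h
  have hρm : ρ ^ m ≤ 2 ^ γ * edist s t ^ γ := two_rpow_neg_pow_le hγ.le hdist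
  have hone : (1 : ℝ≥0∞) ≤ (1 - ρ)⁻¹ := ENNReal.one_le_inv.2 tsub_le_self
  calc edist (g s) (g t)
      ≤ edist (g s) (g (dyadicFloor m s)) + edist (g (dyadicFloor m s)) (g (dyadicFloor m t)) +
          edist (g (dyadicFloor m t)) (g t) := edist_triangle4 _ _ _ _
    _ ≤ A * ρ * ρ ^ m / (1 - ρ) + A * ρ ^ m + A * ρ * ρ ^ m / (1 - ρ) := by
        gcongr
        · exact (edist_comm _ _).trans_le (edist_dyadicFloor_le hg hA hs m)
        · exact edist_dyadicFloor_dyadicFloor_le hA hst.le ht (by rwa [← inv_pow])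
        · exact edist_dyadicFloor_le hg hA ht m
    _ ≤ A * 1 * ρ ^ m * (1 - ρ)⁻¹ + A * ρ ^ m * (1 - ρ)⁻¹ + A * 1 * ρ ^ m * (1 - ρ)⁻¹ := by
        simp only [div_eq_mul_inv]
        gcongr ?_ * _ + ?_ + ?_ * _
        · gcongr
        · exact le_mul_of_one_le_right zero_le hone
        · gcongr
    _ = 3 * (1 - ρ)⁻¹ * A * ρ ^ m := by ring
    _ ≤ 3 * (1 - ρ)⁻¹ * A * (2 ^ γ * edist s t ^ γ) := by gcongr
    _ = _ := by ring

/-- A Besov-type seminorm of `g` on `[0, T]` formed from the increments along the dyadic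
subdivisions of `[0, T]`; for exponents `1 < q` and `0 < γ` it controls the Hölder seminorm of
order `γ`. -/
def dyadicSeminorm (T : ℝ≥0) (γ q : ℝ) (g : ℝ≥0 → E) : ℝ≥0∞ :=
  (∑' m : ℕ, ∑ j ∈ Finset.range (2 ^ m), ((2 ^ γ) ^ m *
    edist (g (j / 2 ^ m * T)) (g ((j + 1) / 2 ^ m * T))) ^ q) ^ q⁻¹

theorem edist_le_dyadicSeminorm {q : ℝ} (hq : 0 < q) (T : ℝ≥0) (γ : ℝ) (g : ℝ≥0 → E) {m j : ℕ}
    (hj : j < 2 ^ m) :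
    edist (g (j / 2 ^ m * T)) (g ((j + 1) / 2 ^ m * T)) ≤
      dyadicSeminorm T γ q g * (2 ^ (-γ)) ^ m := by
  have h : (2 ^ γ) ^ m * edist (g (j / 2 ^ m * T)) (g ((j + 1) / 2 ^ m * T)) ≤
      dyadicSeminorm T γ q g := by
    rw [dyadicSeminorm, ENNReal.le_rpow_inv_iff hq]
    exact (Finset.single_le_sum_of_canonicallyOrdered (f := fun j : ℕ ↦ ((2 ^ γ) ^ m *
      edist (g (j / 2 ^ m * T)) (g ((j + 1) / 2 ^ m * T))) ^ q) (Finset.mem_range.2 hj)).trans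
      (ENNReal.le_tsum m)
  rw [ENNReal.rpow_neg, ← ENNReal.inv_pow, ← div_eq_mul_inv]
  exact (ENNReal.le_div_iff_mul_le (by simp) (by simp)).2 (by rwa [mul_comm])

/-- The constant of the Hölder estimate in terms of `dyadicSeminorm`. -/
def chainConst (T : ℝ≥0) (γ : ℝ) : ℝ≥0∞ :=
  3 * (1 - 2 ^ (-γ))⁻¹ * 2 ^ γ * ((T : ℝ≥0∞) ^ γ)⁻¹

theorem chainConst_ne_top {T : ℝ≥0} {γ : ℝ} (hT : 0 < T) (hγ : 0 < γ) : chainConst T γ ≠ ∞ := by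
  have hρ : (2 : ℝ≥0∞) ^ (-γ) < 1 :=
    ENNReal.rpow_lt_one_of_one_lt_of_neg ENNReal.one_lt_two (by linarith)
  have h1 : (1 - (2 : ℝ≥0∞) ^ (-γ))⁻¹ ≠ ∞ := ENNReal.inv_ne_top.2 (tsub_pos_iff_lt.2 hρ).ne'
  have h2 : ((T : ℝ≥0∞) ^ γ)⁻¹ ≠ ∞ := by simp [hT.ne']
  have h3 : (2 : ℝ≥0∞) ^ γ ≠ ∞ := by simp
  exact ENNReal.mul_ne_top (ENNReal.mul_ne_top (ENNReal.mul_ne_top (by simp) h1) h3) h2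

theorem edist_le_chainConst_mul {q : ℝ} {T : ℝ≥0} {γ : ℝ} (hq : 0 < q) (hT : 0 < T) (hγ : 0 < γ)
    (hg : Continuous g) (hs : s ≤ T) (ht : t ≤ T) :
    edist (g s) (g t) ≤ chainConst T γ * dyadicSeminorm T γ q g * edist s t ^ γ := by
  have h := edist_le_of_dyadic_of_le_one (g := fun u ↦ g (u * T)) (s := s / T) (t := t / T) hγ
    (by fun_prop) (fun m j ↦ edist_le_dyadicSeminorm hq T γ g) (div_le_one_of_le₀ hs zero_le)
    (div_le_one_of_le₀ ht zero_le)
  have hdist : edist (s / T) (t / T) = edist s t * (T : ℝ≥0∞)⁻¹ := by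
    rw [edist_nndist, edist_nndist, NNReal.nndist_eq, NNReal.nndist_eq, ← NNReal.sub_div,
      ← NNReal.sub_div, max_div_div_right zero_le, ENNReal.coe_div hT.ne', div_eq_mul_inv]
  simp only [div_mul_cancel₀ _ hT.ne'] at h
  refine h.trans_eq ?_
  rw [hdist, ENNReal.mul_rpow_of_nonneg _ _ hγ.le, ENNReal.inv_rpow, chainConst]
  ring

end Chaining

/-! ### Gaussian moments -/

/-- A real process which starts at `0`, has continuous paths and has increments `β t - β s` of law
`N(0, (t - s) v)`, for instance a Brownian motion of variance `v`. -/
structure IsGaussianDriver {Ω : Type*} [MeasurableSpace Ω] (P : Measure Ω) (v : ℝ≥0)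
    (β : ℝ≥0 → Ω → ℝ) : Prop where
  aemeasurable : ∀ t, AEMeasurable (β t) P
  zero : ∀ᵐ ω ∂P, β 0 ω = 0
  continuous : ∀ᵐ ω ∂P, Continuous fun t ↦ β t ω
  map_sub_eq : ∀ s t, s ≤ t → P.map (fun ω ↦ β t ω - β s ω) = gaussianReal 0 ((t - s) * v)

/-- The absolute moment of order `q` of the standard normal law. -/
def gaussianMoment (q : ℝ) : ℝ≥0∞ := ∫⁻ x, ‖x‖ₑ ^ q ∂gaussianReal 0 1

theorem gaussianMoment_lt_top {q : ℝ} (hq : 0 < q) : gaussianMoment q < ∞ := by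
  have h := (memLp_id_gaussianReal (μ := 0) (v := 1) q.toNNReal).eLpNorm_lt_top
  rw [eLpNorm_lt_top_iff_lintegral_rpow_enorm_lt_top (by simpa using hq) ENNReal.coe_ne_top] at h
  simpa [gaussianMoment, hq.le] using h

theorem lintegral_enorm_rpow_gaussianReal {q : ℝ} (hq : 0 ≤ q) (v : ℝ≥0) :
    ∫⁻ x, ‖x‖ₑ ^ q ∂gaussianReal 0 v = (v : ℝ≥0∞) ^ (q / 2) * gaussianMoment q := by
  have h := gaussianReal_map_const_mul (μ := 0) (v := 1) (NNReal.sqrt v : ℝ)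
  have hv : NNReal.mk ((NNReal.sqrt v : ℝ) ^ 2) (sq_nonneg _) * 1 = v := by
    rw [mul_one]; ext; simp
  rw [mul_zero, hv] at h
  have hsqrt : ‖(NNReal.sqrt v : ℝ)‖ₑ = (v : ℝ≥0∞) ^ (1 / 2 : ℝ) := by
    rw [enorm_eq_nnnorm, NNReal.nnnorm_eq, NNReal.sqrt_eq_rpow,
      ENNReal.coe_rpow_of_nonneg _ (by norm_num)]
  rw [← h, lintegral_map (by fun_prop) (by fun_prop), gaussianMoment,
    ← lintegral_const_mul _ (by fun_prop)]
  refine lintegral_congr fun x ↦ ?_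
  rw [enorm_mul, ENNReal.mul_rpow_of_nonneg _ _ hq, hsqrt, ← ENNReal.rpow_mul]
  ring_nf

theorem aemeasurable_dyadicSeminorm {Ω : Type*} [MeasurableSpace Ω] {P : Measure Ω}
    {β : ℝ≥0 → Ω → ℝ} (hβ : ∀ t, AEMeasurable (β t) P) (T : ℝ≥0) (γ q : ℝ) :
    AEMeasurable (fun ω ↦ dyadicSeminorm T γ q fun t ↦ β t ω) P := by
  simp only [dyadicSeminorm, edist_eq_enorm_sub]
  exact (AEMeasurable.tsum fun m ↦ Finset.aemeasurable_fun_sum _ fun j _ ↦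
    ((((hβ _).sub (hβ _)).enorm).const_mul _).pow_const _).pow_const _

/-- The constant of the moment bound for `dyadicSeminorm`. -/
def dyadicMomentConst (T : ℝ≥0) (γ q : ℝ) : ℝ≥0∞ :=
  (gaussianMoment q * (T : ℝ≥0∞) ^ (q / 2) *
    ∑' m : ℕ, ((2 : ℝ≥0∞) ^ (1 - q * (1 / 2 - γ))) ^ m) ^ q⁻¹

theorem dyadicMomentConst_lt_top (T : ℝ≥0) {γ q : ℝ} (hq : 0 < q) (hqγ : 1 < q * (1 / 2 - γ)) :
    dyadicMomentConst T γ q < ∞ := by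
  refine ENNReal.rpow_lt_top_of_nonneg (by positivity) (ENNReal.mul_ne_top
    (ENNReal.mul_ne_top (gaussianMoment_lt_top hq).ne
      (ENNReal.rpow_ne_top_of_nonneg (by positivity) ENNReal.coe_ne_top)) ?_)
  rw [ENNReal.tsum_geometric]
  refine ENNReal.inv_ne_top.2 (tsub_pos_of_lt ?_).ne'
  exact ENNReal.rpow_lt_one_of_one_lt_of_neg ENNReal.one_lt_two (by linarith)

namespace IsGaussianDriver

variable {Ω : Type*} [MeasurableSpace Ω] {P : Measure Ω} {v : ℝ≥0} {β : ℝ≥0 → Ω → ℝ}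

theorem lintegral_edist_rpow (hβ : IsGaussianDriver P v β) {q : ℝ} (hq : 0 ≤ q) {s t : ℝ≥0}
    (hst : s ≤ t) :
    ∫⁻ ω, edist (β s ω) (β t ω) ^ q ∂P =
      (((t - s) * v : ℝ≥0) : ℝ≥0∞) ^ (q / 2) * gaussianMoment q := by
  rw [← lintegral_enorm_rpow_gaussianReal hq, ← hβ.map_sub_eq s t hst,
    lintegral_map' (by fun_prop) ((hβ.aemeasurable t).fun_sub (hβ.aemeasurable s))]
  simp only [edist_comm (β s _), edist_eq_enorm_sub]

theorem lintegral_dyadic_edist_rpow (hβ : IsGaussianDriver P v β) (T : ℝ≥0) (γ : ℝ) {q : ℝ}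
    (hq : 0 ≤ q) (m j : ℕ) :
    ∫⁻ ω, ((2 ^ γ) ^ m * edist (β (j / 2 ^ m * T) ω) (β ((j + 1) / 2 ^ m * T) ω)) ^ q ∂P =
      ((2 ^ γ) ^ m) ^ q * (((T / 2 ^ m * v : ℝ≥0) : ℝ≥0∞) ^ (q / 2) * gaussianMoment q) := by
  have hle : (j : ℝ≥0) / 2 ^ m * T ≤ (j + 1) / 2 ^ m * T := by gcongr; simp
  have hstep : ((j : ℝ≥0) + 1) / 2 ^ m * T - j / 2 ^ m * T = T / 2 ^ m := by
    rw [add_div, add_mul, add_tsub_cancel_left]; ring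
  simp only [ENNReal.mul_rpow_of_nonneg _ _ hq]
  rw [lintegral_const_mul' _ _ (by simp), hβ.lintegral_edist_rpow hq hle, hstep]

theorem lintegral_dyadicSeminorm_rpow (hβ : IsGaussianDriver P v β) (T : ℝ≥0) (γ : ℝ) {q : ℝ}
    (hq : 0 < q) :
    (∫⁻ ω, dyadicSeminorm T γ q (fun t ↦ β t ω) ^ q ∂P) ^ q⁻¹ =
      dyadicMomentConst T γ q * (v : ℝ≥0∞) ^ (1 / 2 : ℝ) := by
  have hmeas : ∀ m j : ℕ, AEMeasurable (fun ω ↦ ((2 ^ γ) ^ m *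
      edist (β (j / 2 ^ m * T) ω) (β ((j + 1) / 2 ^ m * T) ω)) ^ q) P := fun m j ↦
    (((hβ.aemeasurable _).edist (hβ.aemeasurable _)).const_mul _).pow_const _
  have hscale : ∀ m : ℕ, (2 : ℝ≥0∞) ^ m * (((2 ^ γ) ^ m) ^ q *
      (((T / 2 ^ m * v : ℝ≥0) : ℝ≥0∞) ^ (q / 2) * gaussianMoment q)) =
        gaussianMoment q * (T : ℝ≥0∞) ^ (q / 2) * (2 ^ (1 - q * (1 / 2 - γ))) ^ m *
          (v : ℝ≥0∞) ^ (q / 2) := by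
    intro m
    have h2 : (2 : ℝ≥0∞) ^ m * ((2 ^ γ) ^ m) ^ q * ((2 ^ m)⁻¹) ^ (q / 2) =
        (2 ^ (1 - q * (1 / 2 - γ))) ^ m := by
      simp only [← ENNReal.rpow_natCast, ← ENNReal.rpow_mul, ← ENNReal.rpow_neg,
        ← ENNReal.rpow_add _ _ two_ne_zero ENNReal.ofNat_ne_top]
      ring_nf
    rw [ENNReal.coe_mul, ENNReal.coe_div (by positivity), div_eq_mul_inv,
      ENNReal.mul_rpow_of_nonneg _ _ (by positivity),
      ENNReal.mul_rpow_of_nonneg _ _ (by positivity), ← h2]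
    push_cast
    ring
  simp only [dyadicSeminorm, ENNReal.rpow_inv_rpow hq.ne']
  rw [lintegral_tsum fun m ↦ Finset.aemeasurable_fun_sum _ fun j _ ↦ hmeas m j]
  simp only [lintegral_finsetSum' _ fun j _ ↦ hmeas _ j,
    hβ.lintegral_dyadic_edist_rpow T γ hq.le, Finset.sum_const,
    Finset.card_range, nsmul_eq_mul, Nat.cast_pow, Nat.cast_ofNat, hscale]
  rw [ENNReal.tsum_mul_right, ENNReal.tsum_mul_left, ENNReal.mul_rpow_of_nonneg _ _ (by positivity),
    ← ENNReal.rpow_mul, dyadicMomentConst]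
  congr 2
  field_simp

end IsGaussianDriver

/-! ### Weighted `ℓ²` norms of random sequences -/

section WeightedNorm

variable {ι : Type*}

/-- The norm of the sequence `y` in `ℓ²` with the weight `w`. -/
def weightedNorm (w y : ι → ℝ≥0∞) : ℝ≥0∞ := (∑' i, w i * y i ^ 2) ^ (1 / 2 : ℝ)

theorem weightedNorm_lt_top_iff {w y : ι → ℝ≥0∞} :
    weightedNorm w y < ∞ ↔ ∑' i, w i * y i ^ 2 < ∞ :=
  ENNReal.rpow_lt_top_iff_of_pos (by norm_num)

theorem weightedNorm_mono (w : ι → ℝ≥0∞) {y y' : ι → ℝ≥0∞} (h : ∀ i, y i ≤ y' i) :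
    weightedNorm w y ≤ weightedNorm w y' := by
  rw [weightedNorm, weightedNorm]
  gcongr with i
  exact h i

theorem weightedNorm_const_mul (w : ι → ℝ≥0∞) (c : ℝ≥0∞) (y : ι → ℝ≥0∞) :
    weightedNorm w (fun i ↦ c * y i) = c * weightedNorm w y := by
  have hc : (c ^ 2) ^ (1 / 2 : ℝ) = c := by
    rw [← ENNReal.rpow_natCast, ← ENNReal.rpow_mul]; norm_num
  simp only [weightedNorm, mul_pow, mul_left_comm _ (c ^ 2)]
  rw [ENNReal.tsum_mul_left, ENNReal.mul_rpow_of_nonneg _ _ (by norm_num), hc]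

theorem tendsto_weightedNorm_zero [Countable ι] {α : Type*} {l : Filter α}
    [l.IsCountablyGenerated] {w Y : ι → ℝ≥0∞} {y : α → ι → ℝ≥0∞} (hw : ∀ i, w i ≠ ∞)
    (hY : weightedNorm w Y < ∞) (hlim : ∀ i, Tendsto (fun r ↦ y r i) l (𝓝 0))
    (hle : ∀ᶠ r in l, ∀ i, y r i ≤ Y i) : Tendsto (fun r ↦ weightedNorm w (y r)) l (𝓝 0) := by
  let _ : MeasurableSpace ι := ⊤
  have hsum : Tendsto (fun r ↦ ∑' i, w i * y r i ^ 2) l (𝓝 0) := by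
    simp only [← lintegral_count]
    rw [← lintegral_zero (μ := Measure.count (α := ι))]
    refine tendsto_lintegral_filter_of_dominated_convergence (fun i ↦ w i * Y i ^ 2)
      (.of_forall fun r ↦ measurable_of_countable _) ?_ ?_ (ae_of_all _ fun i ↦ ?_)
    · filter_upwards [hle] with r hr
      refine ae_of_all _ fun i ↦ ?_
      gcongr
      exact hr i
    · rw [lintegral_count]
      exact (weightedNorm_lt_top_iff.1 hY).ne
    · simpa using ENNReal.Tendsto.const_mul (((ENNReal.continuous_pow 2).tendsto 0).comp (hlim i))
        (Or.inr (hw i))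
  simpa [weightedNorm, Function.comp_def] using
    ((ENNReal.continuous_rpow_const (y := (1 / 2 : ℝ))).tendsto 0).comp hsum

theorem lowerSemicontinuous_weightedNorm {S : Type*} [TopologicalSpace S] {w : ι → ℝ≥0∞}
    {y : S → ι → ℝ≥0∞} (hw : ∀ i, w i ≠ ∞) (hy : ∀ i, Continuous fun x ↦ y x i) :
    LowerSemicontinuous fun x ↦ weightedNorm w (y x) := by
  have hsum : LowerSemicontinuous fun x ↦ ∑' i, w i * y x i ^ 2 :=
    lowerSemicontinuous_tsum fun i ↦ Continuous.lowerSemicontinuous <|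
      (ENNReal.continuous_const_mul (hw i)).comp ((ENNReal.continuous_pow 2).comp (hy i))
  exact ENNReal.continuous_rpow_const.comp_lowerSemicontinuous hsum
    (ENNReal.monotone_rpow_of_nonneg (by norm_num))

variable {Ω : Type*} [MeasurableSpace Ω] {P : Measure Ω}

theorem aemeasurable_weightedNorm [Countable ι] (w : ι → ℝ≥0∞) {y : Ω → ι → ℝ≥0∞}
    (hy : ∀ i, AEMeasurable (fun ω ↦ y ω i) P) : AEMeasurable (fun ω ↦ weightedNorm w (y ω)) P :=
  (AEMeasurable.tsum fun i ↦ ((hy i).pow_const 2).const_mul (w i)).pow_const _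

theorem aemeasurable_iSup_of_lowerSemicontinuous {S : Type*} [TopologicalSpace S]
    [SecondCountableTopology S] {F : S → Ω → ℝ≥0∞} (hm : ∀ x, AEMeasurable (F x) P)
    (hF : ∀ᵐ ω ∂P, LowerSemicontinuous fun x ↦ F x ω) :
    AEMeasurable (fun ω ↦ ⨆ x, F x ω) P := by
  obtain ⟨D, hD_countable, hD⟩ := TopologicalSpace.exists_countable_dense S
  have := hD_countable.to_subtype
  refine (AEMeasurable.iSup fun x : D ↦ hm x).congr ?_
  filter_upwards [hF] with ω hω
  refine le_antisymm (iSup_le fun x ↦ le_iSup (F · ω) x.1)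
    (iSup_le fun x ↦ le_of_forall_lt fun y hy ↦ ?_)
  obtain ⟨x', hx'D, hx'⟩ := hD.exists_mem_open (hω.isOpen_preimage y) ⟨x, hy⟩
  exact lt_of_lt_of_le hx' (le_iSup (fun x : D ↦ F x ω) ⟨x', hx'D⟩)

theorem aemeasurable_iSup_weightedNorm [Countable ι] {S : Type*} [TopologicalSpace S]
    [SecondCountableTopology S] {w : ι → ℝ≥0∞} {y : S → Ω → ι → ℝ≥0∞} (hw : ∀ i, w i ≠ ∞)
    (hm : ∀ x i, AEMeasurable (fun ω ↦ y x ω i) P)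
    (hc : ∀ᵐ ω ∂P, ∀ i, Continuous fun x ↦ y x ω i) :
    AEMeasurable (fun ω ↦ ⨆ x, weightedNorm w (y x ω)) P :=
  aemeasurable_iSup_of_lowerSemicontinuous (fun x ↦ aemeasurable_weightedNorm w (hm x))
    (hc.mono fun _ hω ↦ lowerSemicontinuous_weightedNorm hw hω)

theorem lintegral_finset_sum_rpow_le {f : ι → Ω → ℝ≥0∞} (hf : ∀ i, AEMeasurable (f i) P) {p : ℝ}
    (hp : 1 ≤ p) (F : Finset ι) :
    (∫⁻ ω, (∑ i ∈ F, f i ω) ^ p ∂P) ^ (1 / p) ≤ ∑ i ∈ F, (∫⁻ ω, f i ω ^ p ∂P) ^ (1 / p) := by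
  classical
  have hp0 : 0 < p := by linarith
  induction F using Finset.induction_on with
  | empty => simp [hp0]
  | insert i F hi ih =>
    simp only [Finset.sum_insert hi]
    exact (ENNReal.lintegral_Lp_add_le (hf i) (Finset.aemeasurable_fun_sum _ fun j _ ↦ hf j)
      hp).trans (add_le_add le_rfl ih)

theorem lintegral_tsum_rpow_le [Countable ι] {f : ι → Ω → ℝ≥0∞} (hf : ∀ i, AEMeasurable (f i) P)
    {p : ℝ} (hp : 1 ≤ p) :
    (∫⁻ ω, (∑' i, f i ω) ^ p ∂P) ^ (1 / p) ≤ ∑' i, (∫⁻ ω, f i ω ^ p ∂P) ^ (1 / p) := by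
  have hp0 : 0 < p := by linarith
  have hsup : ∀ ω, (∑' i, f i ω) ^ p = ⨆ F : Finset ι, (∑ i ∈ F, f i ω) ^ p := fun ω ↦ by
    rw [ENNReal.tsum_eq_iSup_sum]
    exact (ENNReal.orderIsoRpow p hp0).map_iSup _
  have hmono : Monotone fun (F : Finset ι) ω ↦ (∑ i ∈ F, f i ω) ^ p := fun F F' h ω ↦
    ENNReal.rpow_le_rpow (Finset.sum_le_sum_of_subset h) hp0.le
  simp only [hsup]
  rw [lintegral_iSup_directed
    (fun F ↦ (Finset.aemeasurable_fun_sum _ fun j _ ↦ hf j).pow_const _) hmono.directed_le,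
    one_div, ENNReal.rpow_inv_le_iff hp0]
  refine iSup_le fun F ↦ ?_
  rw [← ENNReal.rpow_inv_le_iff hp0, ← one_div]
  exact (lintegral_finset_sum_rpow_le hf hp F).trans (ENNReal.sum_le_tsum F)

theorem lintegral_weightedNorm_rpow_le [Countable ι] (w : ι → ℝ≥0∞) {y : Ω → ι → ℝ≥0∞}
    (hy : ∀ i, AEMeasurable (fun ω ↦ y ω i) P) {q : ℝ} (hq : 2 ≤ q) :
    (∫⁻ ω, weightedNorm w (y ω) ^ q ∂P) ^ q⁻¹ ≤
      weightedNorm w fun i ↦ (∫⁻ ω, y ω i ^ q ∂P) ^ q⁻¹ := by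
  have hterm : ∀ i, (∫⁻ ω, (w i * y ω i ^ 2) ^ (q / 2) ∂P) ^ (1 / (q / 2)) =
      w i * ((∫⁻ ω, y ω i ^ q ∂P) ^ q⁻¹) ^ 2 := fun i ↦ by
    have hpow : ∀ ω, (w i * y ω i ^ 2) ^ (q / 2) = w i ^ (q / 2) * y ω i ^ q := fun ω ↦ by
      rw [ENNReal.mul_rpow_of_nonneg _ _ (by positivity), ← ENNReal.rpow_natCast,
        ← ENNReal.rpow_mul]
      push_cast
      ring_nf
    simp only [hpow]
    rw [lintegral_const_mul'' _ ((hy i).pow_const q),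
      ENNReal.mul_rpow_of_nonneg _ _ (by positivity), ← ENNReal.rpow_natCast, ← ENNReal.rpow_mul,
      ← ENNReal.rpow_mul, mul_one_div_cancel (by linarith), ENNReal.rpow_one]
    push_cast
    ring_nf
  have h := lintegral_tsum_rpow_le (P := P) (f := fun i ω ↦ w i * y ω i ^ 2)
    (fun i ↦ ((hy i).pow_const 2).const_mul (w i)) (by linarith : 1 ≤ q / 2)
  simp only [hterm] at h
  calc (∫⁻ ω, weightedNorm w (y ω) ^ q ∂P) ^ q⁻¹
      = ((∫⁻ ω, (∑' i, w i * y ω i ^ 2) ^ (q / 2) ∂P) ^ (1 / (q / 2))) ^ (1 / 2 : ℝ) := by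
        simp only [weightedNorm, ← ENNReal.rpow_mul]
        congr 1
        · ring_nf
        · field_simp
    _ ≤ _ := by rw [weightedNorm]; gcongr

end WeightedNorm

/-- A random variable in `[0, ∞]` all of whose moments are finite. -/
structure HasAllMoments {Ω : Type*} [MeasurableSpace Ω] (P : Measure Ω) (F : Ω → ℝ≥0∞) :
    Prop where
  aemeasurable : AEMeasurable F P
  lintegral_pow_lt_top : ∀ l : ℕ, ∫⁻ ω, F ω ^ l ∂P < ∞

namespace HasAllMoments

variable {Ω : Type*} [MeasurableSpace Ω] {P : Measure Ω} {F G : Ω → ℝ≥0∞}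

theorem congr (hF : HasAllMoments P F) (h : F =ᵐ[P] G) : HasAllMoments P G where
  aemeasurable := hF.aemeasurable.congr h
  lintegral_pow_lt_top l := by
    rw [← lintegral_congr_ae (h.mono fun ω hω ↦ congrArg (· ^ l) hω)]
    exact hF.lintegral_pow_lt_top l

theorem of_frequently_rpow [IsFiniteMeasure P] (hF : AEMeasurable F P)
    (h : ∃ᶠ q : ℝ in atTop, ∫⁻ ω, F ω ^ q ∂P < ∞) : HasAllMoments P F where
  aemeasurable := hF
  lintegral_pow_lt_top l := by
    obtain ⟨q, hq, hlq⟩ := (h.and_eventually (eventually_ge_atTop (l : ℝ))).exists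
    have hle : ∀ ω, F ω ^ l ≤ 1 + F ω ^ q := fun ω ↦ by
      rcases le_total (F ω) 1 with h1 | h1
      · exact (pow_le_one₀ zero_le h1).trans le_self_add
      · rw [← ENNReal.rpow_natCast]
        exact (ENNReal.rpow_le_rpow_of_exponent_le h1 hlq).trans le_add_self
    refine (lintegral_mono hle).trans_lt ?_
    rw [lintegral_add_left measurable_const, lintegral_const, one_mul]
    exact ENNReal.add_lt_top.2 ⟨measure_lt_top P _, hq⟩

theorem add (hF : HasAllMoments P F) (hG : HasAllMoments P G) :
    HasAllMoments P fun ω ↦ F ω + G ω where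
  aemeasurable := hF.aemeasurable.add hG.aemeasurable
  lintegral_pow_lt_top l := by
    have hle : ∀ ω, (F ω + G ω) ^ l ≤ 2 ^ l * (F ω ^ l + G ω ^ l) := fun ω ↦
      calc (F ω + G ω) ^ l ≤ (2 * max (F ω) (G ω)) ^ l := by
            rw [two_mul]
            gcongr
            exacts [le_max_left _ _, le_max_right _ _]
        _ = 2 ^ l * max (F ω ^ l) (G ω ^ l) := by rw [mul_pow, (pow_left_mono l).map_max]
        _ ≤ 2 ^ l * (F ω ^ l + G ω ^ l) := by
            gcongr
            exact max_le le_self_add le_add_self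
    refine (lintegral_mono hle).trans_lt ?_
    rw [lintegral_const_mul' _ _ (by simp), lintegral_add_left' (hF.aemeasurable.pow_const l)]
    exact ENNReal.mul_lt_top (by simp) (ENNReal.add_lt_top.2
      ⟨hF.lintegral_pow_lt_top l, hG.lintegral_pow_lt_top l⟩)

end HasAllMoments

/-! ### Systems of Ornstein–Uhlenbeck processes -/

section Pathwise

variable {ι E : Type*} [NormedAddCommGroup E] [NormedSpace ℝ E] {a : ι → ℝ}
  {b : ι → ℝ≥0 → E} {T t : ℝ≥0} {γ q : ℝ}

theorem enorm_ouPath_le_dyadicSeminorm [CompleteSpace E] {a : ℝ} {b : ℝ≥0 → E} (ha : 0 < a)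
    (hb : Continuous b) (hγ : 0 < γ) (hq : 0 < q) (hT : 0 < T) (ht : t ≤ T) :
    ‖ouPath a b t‖ₑ ≤ chainConst T γ * ENNReal.ofReal (Real.Gamma (γ + 1)) *
      (ENNReal.ofReal (a ^ (-γ)) * dyadicSeminorm T γ q b) := by
  refine (enorm_ouPath_le ha hb hγ.le (fun s hs t ht ↦ edist_le_chainConst_mul hq hT hγ hb ht hs)
    ht).trans_eq ?_
  rw [ENNReal.ofReal_mul (Real.Gamma_pos_of_pos (by linarith)).le]
  ring

theorem weightedNorm_ouPath_le [CompleteSpace E] (w : ι → ℝ≥0∞) (ha : ∀ i, 0 < a i)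
    (hb : ∀ i, Continuous (b i)) (hγ : 0 < γ) (hq : 0 < q) (hT : 0 < T) (ht : t ≤ T) :
    weightedNorm w (fun i ↦ ‖ouPath (a i) (b i) t‖ₑ) ≤
      chainConst T γ * ENNReal.ofReal (Real.Gamma (γ + 1)) *
        weightedNorm w fun i ↦ ENNReal.ofReal (a i ^ (-γ)) * dyadicSeminorm T γ q (b i) := by
  rw [← weightedNorm_const_mul]
  exact weightedNorm_mono w fun i ↦ enorm_ouPath_le_dyadicSeminorm (ha i) (hb i) hγ hq hT ht

theorem weightedNorm_edist_ouPath_le (w : ι → ℝ≥0∞) (ha : ∀ i, 0 < a i)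
    (hb : ∀ i, Continuous (b i)) (hγ : 0 < γ) (hq : 0 < q) (hT : 0 < T) {s : ℝ≥0} (hs : s ≤ T)
    (ht : t ≤ T) :
    weightedNorm w (fun i ↦ edist (ouPath (a i) (b i) t) (ouPath (a i) (b i) s)) ≤
      2 * chainConst T γ * weightedNorm w (fun i ↦ dyadicSeminorm T γ q (b i)) *
        edist t s ^ γ := by
  rw [mul_right_comm, ← weightedNorm_const_mul]
  refine weightedNorm_mono w fun i ↦ (edist_ouPath_le (ha i) (hb i) hγ.le
    (fun s hs t ht ↦ edist_le_chainConst_mul hq hT hγ (hb i) ht hs) hs ht).trans_eq ?_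
  ring

theorem tendsto_weightedNorm_edist_ouPath [CompleteSpace E] [Countable ι] {w : ι → ℝ≥0∞}
    (hw : ∀ i, w i ≠ ∞) (ha : ∀ i, 0 < a i) (hb : ∀ i, Continuous (b i)) (hγ : 0 < γ)
    (hq : 0 < q) (hT : 0 < T)
    (hfin : weightedNorm w (fun i ↦ ENNReal.ofReal (a i ^ (-γ)) * dyadicSeminorm T γ q (b i)) < ∞)
    (ht : t ≤ T) :
    Tendsto (fun r ↦ weightedNorm w fun i ↦ edist (ouPath (a i) (b i) r) (ouPath (a i) (b i) t))
      (𝓝[Set.Iic T] t) (𝓝 0) := by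
  set C := 2 * (chainConst T γ * ENNReal.ofReal (Real.Gamma (γ + 1)))
  have hC : C ≠ ∞ :=
    ENNReal.mul_ne_top (by simp) (ENNReal.mul_ne_top (chainConst_ne_top hT hγ) (by simp))
  refine tendsto_weightedNorm_zero hw
    (Y := fun i ↦ C * (ENNReal.ofReal (a i ^ (-γ)) * dyadicSeminorm T γ q (b i))) ?_
    (fun i ↦ ?_) ?_
  · rw [weightedNorm_const_mul]
    exact ENNReal.mul_lt_top hC.lt_top hfin
  · exact (tendsto_iff_edist_tendsto_0.1 ((continuous_ouPath (ha i) (hb i)).tendsto t)).mono_left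
      nhdsWithin_le_nhds
  · filter_upwards [self_mem_nhdsWithin] with r hr i
    rw [edist_eq_enorm_sub, mul_assoc, two_mul]
    exact enorm_sub_le.trans (add_le_add (enorm_ouPath_le_dyadicSeminorm (ha i) (hb i) hγ hq hT hr)
      (enorm_ouPath_le_dyadicSeminorm (ha i) (hb i) hγ hq hT ht))

end Pathwise

section Moments

variable {ι : Type*} [Countable ι] {Ω : Type*} [MeasurableSpace Ω] {P : Measure Ω}
  {w : ι → ℝ≥0∞} {a : ι → ℝ} {v : ι → ℝ≥0} {β : ι → ℝ≥0 → Ω → ℝ} {T : ℝ≥0} {γ q : ℝ}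

theorem aemeasurable_iSup_weightedNorm_edist_div {X : ι → ℝ≥0 → Ω → ℝ} (hw : ∀ i, w i ≠ ∞)
    (hm : ∀ i t, AEMeasurable (X i t) P) (hc : ∀ᵐ ω ∂P, ∀ i, Continuous fun t ↦ X i t ω)
    (T : ℝ≥0) (γ : ℝ) :
    AEMeasurable (fun ω ↦ ⨆ r ∈ Set.Iic T, ⨆ t ∈ Set.Iic T, ⨆ _ : r ≠ t,
      weightedNorm w (fun i ↦ edist (X i t ω) (X i r ω)) / edist t r ^ γ) P := by
  let Pairs := {x : ℝ≥0 × ℝ≥0 // x.1 ∈ Set.Iic T ∧ x.2 ∈ Set.Iic T ∧ x.1 ≠ x.2}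
  have hsup : ∀ ω, (⨆ r ∈ Set.Iic T, ⨆ t ∈ Set.Iic T, ⨆ _ : r ≠ t,
      weightedNorm w (fun i ↦ edist (X i t ω) (X i r ω)) / edist t r ^ γ) =
        ⨆ x : Pairs, weightedNorm w fun i ↦
          (edist x.1.2 x.1.1 ^ γ)⁻¹ * edist (X i x.1.2 ω) (X i x.1.1 ω) := fun ω ↦ by
    simp only [weightedNorm_const_mul, Pairs, iSup_subtype, iSup_prod, iSup_and,
      ENNReal.div_eq_inv_mul]
    exact iSup_congr fun r ↦ iSup_comm.symm
  have hne : ∀ x : Pairs, edist x.1.2 x.1.1 ^ γ ≠ 0 := fun x ↦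
    (ENNReal.rpow_pos (edist_pos.2 x.2.2.2.symm) (edist_ne_top _ _)).ne'
  simp only [hsup]
  refine aemeasurable_iSup_weightedNorm hw
    (fun x i ↦ ((hm i _).edist (hm i _)).const_mul _) (hc.mono fun ω hω i ↦ ?_)
  have hinv : Continuous fun x : Pairs ↦ (edist x.1.2 x.1.1 ^ γ)⁻¹ :=
    (ENNReal.continuous_rpow_const.comp (by fun_prop)).inv
  have hX : Continuous fun x : Pairs ↦ edist (X i x.1.2 ω) (X i x.1.1 ω) :=
    ((hω i).comp (by fun_prop)).edist ((hω i).comp (by fun_prop))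
  exact continuous_iff_continuousAt.2 fun x ↦ ENNReal.Tendsto.mul (hinv.tendsto x)
    (.inr (edist_ne_top _ _)) (hX.tendsto x) (.inr (ENNReal.inv_ne_top.2 (hne x)))

theorem lintegral_weightedNorm_dyadicSeminorm_lt_top (hβ : ∀ i, IsGaussianDriver P (v i) (β i))
    {c : ι → ℝ≥0∞} (hc : ∀ i, c i ≠ ∞)
    (hfin : weightedNorm w (fun i ↦ c i * (v i : ℝ≥0∞) ^ (1 / 2 : ℝ)) < ∞) (T : ℝ≥0) (hq : 2 ≤ q)
    (hqγ : 1 < q * (1 / 2 - γ)) :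
    ∫⁻ ω, weightedNorm w (fun i ↦ c i * dyadicSeminorm T γ q fun t ↦ β i t ω) ^ q ∂P < ∞ := by
  have hq0 : 0 < q := by linarith
  have hterm : ∀ i, (∫⁻ ω, (c i * dyadicSeminorm T γ q fun t ↦ β i t ω) ^ q ∂P) ^ q⁻¹ =
      dyadicMomentConst T γ q * (c i * (v i : ℝ≥0∞) ^ (1 / 2 : ℝ)) := fun i ↦ by
    simp only [ENNReal.mul_rpow_of_nonneg _ _ hq0.le]
    rw [lintegral_const_mul' _ _ (ENNReal.rpow_ne_top_of_nonneg hq0.le (hc i)),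
      ENNReal.mul_rpow_of_nonneg _ _ (by positivity), ENNReal.rpow_rpow_inv hq0.ne',
      (hβ i).lintegral_dyadicSeminorm_rpow T γ hq0, mul_left_comm]
  rw [← ENNReal.rpow_lt_top_iff_of_pos (inv_pos.2 hq0)]
  refine (lintegral_weightedNorm_rpow_le w (fun i ↦ (aemeasurable_dyadicSeminorm
    (hβ i).aemeasurable T γ q).const_mul (c i)) hq).trans_lt ?_
  simp only [hterm, weightedNorm_const_mul]
  exact ENNReal.mul_lt_top (dyadicMomentConst_lt_top T hq0 hqγ) hfin

theorem eventually_two_le_and_one_lt_mul (hγ : γ < 1 / 2) :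
    ∀ᶠ q : ℝ in atTop, 2 ≤ q ∧ 1 < q * (1 / 2 - γ) :=
  (eventually_ge_atTop 2).and
    ((tendsto_id.atTop_mul_const (by linarith : 0 < 1 / 2 - γ)).eventually_gt_atTop 1)

theorem hasAllMoments_of_le_dyadicSeminorm [IsFiniteMeasure P]
    (hβ : ∀ i, IsGaussianDriver P (v i) (β i)) {c : ι → ℝ≥0∞} (hc : ∀ i, c i ≠ ∞)
    (hfin : weightedNorm w (fun i ↦ c i * (v i : ℝ≥0∞) ^ (1 / 2 : ℝ)) < ∞) (hγ : γ < 1 / 2)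
    {F : Ω → ℝ≥0∞} (hF : AEMeasurable F P) {C : ℝ≥0∞} (hC : C ≠ ∞)
    (hle : ∀ q : ℝ, 0 < q → ∀ᵐ ω ∂P,
      F ω ≤ C * weightedNorm w fun i ↦ c i * dyadicSeminorm T γ q fun t ↦ β i t ω) :
    HasAllMoments P F := by
  refine .of_frequently_rpow hF ((eventually_two_le_and_one_lt_mul hγ).mono ?_).frequently
  rintro q ⟨hq, hqγ⟩
  have hq0 : 0 < q := by linarith
  calc ∫⁻ ω, F ω ^ q ∂P
      ≤ ∫⁻ ω, (C * weightedNorm w fun i ↦ c i * dyadicSeminorm T γ q fun t ↦ β i t ω) ^ q ∂P :=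
        lintegral_mono_ae ((hle q hq0).mono fun ω hω ↦ ENNReal.rpow_le_rpow hω hq0.le)
    _ = C ^ q *
          ∫⁻ ω, weightedNorm w (fun i ↦ c i * dyadicSeminorm T γ q fun t ↦ β i t ω) ^ q ∂P := by
        simp only [ENNReal.mul_rpow_of_nonneg _ _ hq0.le]
        exact lintegral_const_mul' _ _ (ENNReal.rpow_ne_top_of_nonneg hq0.le hC)
    _ < ∞ := ENNReal.mul_lt_top (ENNReal.rpow_lt_top_of_nonneg hq0.le hC)
        (lintegral_weightedNorm_dyadicSeminorm_lt_top hβ hc hfin T hq hqγ)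

theorem ae_tendsto_weightedNorm_edist_ouPath (hβ : ∀ i, IsGaussianDriver P (v i) (β i))
    (hw : ∀ i, w i ≠ ∞) (ha : ∀ i, 0 < a i) (hγ : 0 < γ) (hγ' : γ < 1 / 2) (hT : 0 < T)
    (hfin : weightedNorm w
      (fun i ↦ ENNReal.ofReal (a i ^ (-γ)) * (v i : ℝ≥0∞) ^ (1 / 2 : ℝ)) < ∞) :
    ∀ᵐ ω ∂P, ∀ t ≤ T, Tendsto (fun r ↦ weightedNorm w fun i ↦
      edist (ouPath (a i) (fun s ↦ β i s ω) r) (ouPath (a i) (fun s ↦ β i s ω) t))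
        (𝓝[Set.Iic T] t) (𝓝 0) := by
  obtain ⟨q, hq, hqγ⟩ := (eventually_two_le_and_one_lt_mul hγ').exists
  have hq0 : 0 < q := by linarith
  have hmeas : AEMeasurable (fun ω ↦ weightedNorm w (fun i ↦ ENNReal.ofReal (a i ^ (-γ)) *
      dyadicSeminorm T γ q fun t ↦ β i t ω) ^ q) P :=
    (aemeasurable_weightedNorm w fun i ↦ (aemeasurable_dyadicSeminorm
      (hβ i).aemeasurable T γ q).const_mul _).pow_const q
  filter_upwards [ae_lt_top' hmeas (lintegral_weightedNorm_dyadicSeminorm_lt_top hβ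
      (fun i ↦ ENNReal.ofReal_ne_top) hfin T hq hqγ).ne, ae_all_iff.2 fun i ↦ (hβ i).continuous]
    with ω hω hc t ht
  exact tendsto_weightedNorm_edist_ouPath hw ha hc hγ hq0 hT
    ((ENNReal.rpow_lt_top_iff_of_pos hq0).1 hω) ht

theorem hasAllMoments_iSup_weightedNorm_ouPath [IsFiniteMeasure P]
    (hβ : ∀ i, IsGaussianDriver P (v i) (β i)) (hw : ∀ i, w i ≠ ∞) (ha : ∀ i, 0 < a i)
    (hγ : 0 < γ) (hγ' : γ < 1 / 2) (hT : 0 < T)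
    (hfin : weightedNorm w
      (fun i ↦ ENNReal.ofReal (a i ^ (-γ)) * (v i : ℝ≥0∞) ^ (1 / 2 : ℝ)) < ∞) :
    HasAllMoments P fun ω ↦ ⨆ t ∈ Set.Iic T,
      weightedNorm w fun i ↦ ‖ouPath (a i) (fun s ↦ β i s ω) t‖ₑ := by
  have hc : ∀ᵐ ω ∂P, ∀ i, Continuous fun t ↦ β i t ω := ae_all_iff.2 fun i ↦ (hβ i).continuous
  refine hasAllMoments_of_le_dyadicSeminorm (T := T)
    (C := chainConst T γ * ENNReal.ofReal (Real.Gamma (γ + 1))) hβ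
    (fun i ↦ ENNReal.ofReal_ne_top) hfin hγ' ?_
    (ENNReal.mul_ne_top (chainConst_ne_top hT hγ) ENNReal.ofReal_ne_top) fun q hq ↦ ?_
  · simp only [← iSup_subtype'']
    refine aemeasurable_iSup_weightedNorm hw (fun t i ↦
      (aemeasurable_ouPath (ha i) (hβ i).aemeasurable (hβ i).continuous t).enorm) ?_
    filter_upwards [hc] with ω hω i
    exact ((continuous_ouPath (ha i) (hω i)).comp continuous_subtype_val).enorm
  · filter_upwards [hc] with ω hω
    exact iSup₂_le fun t ht ↦ weightedNorm_ouPath_le w ha hω hγ hq hT ht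

theorem hasAllMoments_iSup_weightedNorm_edist_ouPath_div [IsFiniteMeasure P]
    (hβ : ∀ i, IsGaussianDriver P (v i) (β i)) (hw : ∀ i, w i ≠ ∞) (ha : ∀ i, 0 < a i)
    (hγ : 0 < γ) (hγ' : γ < 1 / 2) (hT : 0 < T)
    (hfin : weightedNorm w (fun i ↦ (v i : ℝ≥0∞) ^ (1 / 2 : ℝ)) < ∞) :
    HasAllMoments P fun ω ↦ ⨆ r ∈ Set.Iic T, ⨆ t ∈ Set.Iic T, ⨆ _ : r ≠ t,
      weightedNorm w (fun i ↦ edist (ouPath (a i) (fun s ↦ β i s ω) t)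
        (ouPath (a i) (fun s ↦ β i s ω) r)) / edist t r ^ γ := by
  have hc : ∀ᵐ ω ∂P, ∀ i, Continuous fun t ↦ β i t ω := ae_all_iff.2 fun i ↦ (hβ i).continuous
  refine hasAllMoments_of_le_dyadicSeminorm (T := T) hβ (c := fun _ ↦ 1)
    (fun _ ↦ ENNReal.one_ne_top) (by simpa using hfin) hγ' ?_
    (C := 2 * chainConst T γ)
    (ENNReal.mul_ne_top ENNReal.ofNat_ne_top (chainConst_ne_top hT hγ)) fun q hq ↦ ?_
  · refine aemeasurable_iSup_weightedNorm_edist_div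
      (X := fun i t ω ↦ ouPath (a i) (fun s ↦ β i s ω) t) hw (fun i t ↦
        aemeasurable_ouPath (ha i) (hβ i).aemeasurable (hβ i).continuous t) ?_ T γ
    filter_upwards [hc] with ω hω i using continuous_ouPath (ha i) (hω i)
  · filter_upwards [hc] with ω hω
    refine iSup₂_le fun r hr ↦ iSup₂_le fun t ht ↦ iSup_le fun _ ↦ ENNReal.div_le_of_le_mul ?_
    simpa only [one_mul] using weightedNorm_edist_ouPath_le w ha hω hγ hq hT hr ht

end Moments

/-! ### Trigonometric fields and Fourier coefficients -/

section Fourier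

variable {n d : ℕ}

theorem linearMap_eq_sum_single {F : Type*} [AddCommGroup F] [Module ℝ F]
    (L : EuclideanSpace ℝ (Fin d) →ₗ[ℝ] F) (v : EuclideanSpace ℝ (Fin d)) :
    L v = ∑ c, v c • L (EuclideanSpace.single c 1) := by
  conv_lhs => rw [← (EuclideanSpace.basisFun (Fin d) ℝ).sum_repr v, map_sum]
  simp only [EuclideanSpace.basisFun_repr, EuclideanSpace.basisFun_apply, map_smul]

theorem norm_linearMap_sq_le {F : Type*} [NormedAddCommGroup F] [NormedSpace ℝ F]
    (L : EuclideanSpace ℝ (Fin d) →ₗ[ℝ] F) (v : EuclideanSpace ℝ (Fin d)) :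
    ‖L v‖ ^ 2 ≤ ‖v‖ ^ 2 * ∑ c, ‖L (EuclideanSpace.single c 1)‖ ^ 2 := by
  have hle : ‖L v‖ ≤ ∑ c, ‖v c‖ * ‖L (EuclideanSpace.single c 1)‖ := by
    rw [linearMap_eq_sum_single L v]
    exact (norm_sum_le _ _).trans_eq (Finset.sum_congr rfl fun c _ ↦ norm_smul _ _)
  rw [EuclideanSpace.norm_sq_eq]
  exact (pow_le_pow_left₀ (norm_nonneg _) hle 2).trans (Finset.sum_mul_sq_le_sq_mul_sq _ _ _)

theorem character_neg (k : Fin n → ℤ) (x : Torus n) :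
    character (-k) x = starRingEnd ℂ (character k x) := by
  simp [character, map_prod]

theorem character_add (k l : Fin n → ℤ) (x : Torus n) :
    character (k + l) x = character k x * character l x := by
  simp only [character, ContinuousMap.coe_mk, Pi.add_apply, fourier_add, Finset.prod_mul_distrib]

theorem norm_character (k : Fin n → ℤ) (x : Torus n) : ‖character k x‖ = 1 := by
  simp only [character, ContinuousMap.coe_mk, norm_prod, fourier_apply, Circle.norm_coe,
    Finset.prod_const_one]

theorem integrable_character (k : Fin n → ℤ) : Integrable fun x : Torus n ↦ character k x :=
  (character k).continuous.integrable_of_hasCompactSupport (.of_compactSpace _)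

theorem integral_character_eq_zero {k : Fin n → ℤ} (hk : k ≠ 0) :
    ∫ x : Torus n, character k x = 0 := by
  obtain ⟨i, hi⟩ := Function.ne_iff.mp hk
  have h : ∫ y : AddCircle (2 * Real.pi), fourier (k i) y = 0 := by
    have h0 := congrFun (fourierCoeff_fourier (T := 2 * Real.pi) (k i)) 0
    rw [Pi.single_eq_of_ne (by simpa using hi.symm)] at h0
    simp only [fourierCoeff, neg_zero, fourier_zero, one_smul] at h0
    rw [AddCircle.volume_eq_smul_haarAddCircle, integral_smul_measure, h0, smul_zero]
  simp only [character, ContinuousMap.coe_mk]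
  rw [integral_fintype_prod_volume_eq_prod
    (f := fun i (y : AddCircle (2 * Real.pi)) ↦ (fourier (k i) y : ℂ))]
  exact Finset.prod_eq_zero (Finset.mem_univ i) h

/-- The functions `cos (k · x)`, for `e = true`, and `sin (k · x)`, for `e = false`. -/
def wave (e : Bool) (k : Fin n → ℤ) (x : Torus n) : ℝ :=
  match e with
  | true => (character k x).re
  | false => (character k x).im

theorem continuous_wave (e : Bool) (k : Fin n → ℤ) : Continuous (wave e k) := by
  cases e
  · exact Complex.continuous_im.comp (character k).continuous
  · exact Complex.continuous_re.comp (character k).continuous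

theorem abs_wave_le_one (e : Bool) (k : Fin n → ℤ) (x : Torus n) : |wave e k x| ≤ 1 := by
  rw [← norm_character k x]
  cases e
  · exact Complex.abs_im_le_norm _
  · exact Complex.abs_re_le_norm _

theorem exists_wave_eq_mul_character_add (e : Bool) (k : Fin n → ℤ) :
    ∃ α β : ℂ, ∀ x, (wave e k x : ℂ) = α * character k x + β * character (-k) x := by
  simp only [character_neg]
  cases e
  · refine ⟨(2 * Complex.I)⁻¹, -(2 * Complex.I)⁻¹, fun x ↦ ?_⟩
    rw [wave, Complex.im_eq_sub_conj]
    ring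
  · refine ⟨2⁻¹, 2⁻¹, fun x ↦ ?_⟩
    rw [wave, Complex.re_eq_add_conj]
    ring

/-- The plane wave `x ↦ cos (k · x) v`, for `e = true`, or `x ↦ sin (k · x) v`, for `e = false`, as
a linear function of its polarization `v`. -/
def waveField (e : Bool) (k : Fin n → ℤ) : EuclideanSpace ℝ (Fin d) →ₗ[ℝ] L2Field n d where
  toFun v := ContinuousMap.toLp 2 (volume : Measure (Torus n)) ℝ
    ⟨fun x ↦ wave e k x • v, (continuous_wave e k).smul continuous_const⟩
  map_add' v w := by
    rw [← map_add]
    congr 1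
    ext1 x
    exact smul_add _ v w
  map_smul' r v := by
    rw [RingHom.id_apply, ← map_smul]
    congr 1
    ext1 x
    exact smul_comm _ r v

theorem cosField_eq_waveField (k : Fin n → ℤ) (c : Fin d) :
    cosField k c = waveField true k (EuclideanSpace.single c 1) := rfl

theorem sinField_eq_waveField (k : Fin n → ℤ) (c : Fin d) :
    sinField k c = waveField false k (EuclideanSpace.single c 1) := rfl

theorem coeFn_waveField (e : Bool) (k : Fin n → ℤ) (v : EuclideanSpace ℝ (Fin d)) :
    waveField e k v =ᵐ[volume] fun x ↦ wave e k x • v :=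
  ContinuousMap.coeFn_toLp (𝕜 := ℝ) (p := 2) volume _

theorem inner_waveField_single (f : L2Field n d) (e : Bool) (k : Fin n → ℤ) (c : Fin d) :
    inner ℝ f (waveField e k (EuclideanSpace.single c 1)) = ∫ x, wave e k x * f x c := by
  rw [L2.inner_def]
  refine integral_congr_ae ?_
  filter_upwards [coeFn_waveField e k (EuclideanSpace.single c (1 : ℝ))] with x hx
  simp only [hx, real_inner_smul_right, EuclideanSpace.inner_single_right, one_mul, conj_trivial]

theorem integrable_wave_mul_component (f : L2Field n d) (e : Bool) (k : Fin n → ℤ) (c : Fin d) :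
    Integrable fun x ↦ wave e k x * f x c :=
  ((EuclideanSpace.proj (𝕜 := ℝ) c).integrable_comp
    ((Lp.memLp f).integrable one_le_two)).bdd_mul (continuous_wave e k).aestronglyMeasurable
      (.of_forall (abs_wave_le_one e k))

theorem fieldCoeff_eq_inner (f : L2Field n d) (k : Fin n → ℤ) (c : Fin d) :
    fieldCoeff f k c = ((2 * Real.pi : ℂ) ^ n)⁻¹ *
      ((inner ℝ f (waveField true k (EuclideanSpace.single c 1)) : ℝ) -
        (inner ℝ f (waveField false k (EuclideanSpace.single c 1)) : ℝ) * Complex.I) := by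
  have hchar : ∀ x, character (-k) x = wave true k x - wave false k x * Complex.I := fun x ↦ by
    rw [character_neg, ← Complex.re_add_im (character k x), map_add, map_mul, Complex.conj_ofReal,
      Complex.conj_ofReal, Complex.conj_I]
    simp [wave, sub_eq_add_neg]
  rw [fieldCoeff, inner_waveField_single, inner_waveField_single, ← integral_complex_ofReal,
    ← integral_complex_ofReal, ← integral_mul_const,
    ← integral_sub (integrable_wave_mul_component f true k c).ofReal
      ((integrable_wave_mul_component f false k c).ofReal.mul_const _)]
  simp only [hchar, Complex.ofReal_mul, sub_mul, mul_right_comm]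

theorem enorm_fieldCoeff_sq (f : L2Field n d) (k : Fin n → ℤ) (c : Fin d) :
    ‖fieldCoeff f k c‖ₑ ^ 2 = ENNReal.ofReal (((2 * Real.pi) ^ n)⁻¹ ^ 2) *
      (‖inner ℝ f (waveField true k (EuclideanSpace.single c 1))‖ₑ ^ 2 +
        ‖inner ℝ f (waveField false k (EuclideanSpace.single c 1))‖ₑ ^ 2) := by
  have hnorm : ∀ x y : ℝ, ‖(x - y * Complex.I : ℂ)‖ ^ 2 = x ^ 2 + y ^ 2 := fun x y ↦ by
    rw [← Complex.normSq_eq_norm_sq, Complex.normSq_apply]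
    simp
    ring
  have hpi : ‖((2 * Real.pi : ℂ) ^ n)⁻¹‖ = ((2 * Real.pi) ^ n)⁻¹ := by
    simp [abs_of_pos Real.pi_pos]
  have henorm : ∀ x : ℝ, ‖x‖ₑ ^ 2 = ENNReal.ofReal (x ^ 2) := fun x ↦ by
    rw [Real.enorm_eq_ofReal_abs, ← ENNReal.ofReal_pow (abs_nonneg x), sq_abs]
  rw [henorm, henorm, ← ENNReal.ofReal_add (sq_nonneg _) (sq_nonneg _),
    ← ENNReal.ofReal_mul (sq_nonneg _), ← ofReal_norm, ← ENNReal.ofReal_pow (norm_nonneg _),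
    fieldCoeff_eq_inner, norm_mul, mul_pow, hpi, hnorm]

/-- The Fourier coefficients of `cos (k · x)` and `sin (k · x)`. -/
def waveCoeff (e : Bool) (k l : Fin n → ℤ) : ℂ :=
  ((2 * Real.pi : ℂ) ^ n)⁻¹ * ∫ x : Torus n, character (-l) x * (wave e k x : ℂ)

theorem waveCoeff_eq_zero (e : Bool) {k l : Fin n → ℤ} (h : l ≠ k) (h' : l ≠ -k) :
    waveCoeff e k l = 0 := by
  obtain ⟨α, β, hwave⟩ := exists_wave_eq_mul_character_add e k
  have hchar : ∀ x, character (-l) x * (wave e k x : ℂ) =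
      α * character (-l + k) x + β * character (-l + -k) x := fun x ↦ by
    rw [hwave, character_add, character_add]
    ring
  simp only [waveCoeff, hchar]
  rw [integral_add ((integrable_character _).const_mul _) ((integrable_character _).const_mul _),
    integral_const_mul, integral_const_mul,
    integral_character_eq_zero fun h0 ↦ h (neg_add_eq_zero.1 h0),
    integral_character_eq_zero fun h0 ↦ h' (neg_add_eq_zero.1 h0)]
  simp

theorem fieldCoeff_waveField (e : Bool) (k l : Fin n → ℤ) (v : EuclideanSpace ℝ (Fin d))
    (c : Fin d) : fieldCoeff (waveField e k v) l c = v c * waveCoeff e k l := by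
  rw [fieldCoeff, waveCoeff, mul_left_comm, ← integral_const_mul (v c : ℂ)]
  congr 1
  refine integral_congr_ae ?_
  filter_upwards [coeFn_waveField e k v] with x hx
  simp only [hx, PiLp.smul_apply, smul_eq_mul, Complex.ofReal_mul]
  ring

theorem isMeanZero_waveField (e : Bool) {k : Fin n → ℤ} (hk : k ≠ 0)
    (v : EuclideanSpace ℝ (Fin d)) : IsMeanZero (waveField e k v) := fun c ↦ by
  rw [fieldCoeff_waveField, waveCoeff_eq_zero e hk.symm (neg_ne_zero.2 hk).symm, mul_zero]

theorem fracSymbol_neg (s : ℝ) (k : Fin n → ℤ) : fracSymbol s (-k) = fracSymbol s k := by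
  simp [fracSymbol]

theorem isFracLaplacian_waveField (s : ℝ) (e : Bool) (k : Fin n → ℤ)
    (v : EuclideanSpace ℝ (Fin d)) :
    IsFracLaplacian s (waveField e k v) (fracSymbol s k • waveField e k v) := fun l c ↦ by
  rw [← map_smul, fieldCoeff_waveField, fieldCoeff_waveField, PiLp.smul_apply, smul_eq_mul,
    Complex.ofReal_mul, mul_assoc]
  rcases eq_or_ne l k with rfl | h
  · rfl
  rcases eq_or_ne l (-k) with rfl | h'
  · rw [fracSymbol_neg]
  · rw [waveCoeff_eq_zero e h h', mul_zero, mul_zero, mul_zero]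

theorem isSmoothField_waveField (e : Bool) (k : Fin n → ℤ) (v : EuclideanSpace ℝ (Fin d)) :
    IsSmoothField (waveField e k v) := fun s ↦ by
  have hsupp : ∀ l ∉ ({k, -k} : Finset (Fin n → ℤ)), ENNReal.ofReal (fracSymbol s l) *
      ∑ c, ‖fieldCoeff (waveField e k v) l c‖ₑ ^ 2 = 0 := fun l hl ↦ by
    simp only [Finset.mem_insert, Finset.mem_singleton, not_or] at hl
    simp [fieldCoeff_waveField, waveCoeff_eq_zero e hl.1 hl.2]
  refine ENNReal.rpow_lt_top_of_nonneg (by norm_num) (ENNReal.mul_ne_top (by simp) ?_)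
  rw [tsum_eq_sum hsupp]
  exact (ENNReal.sum_lt_top.2 fun l _ ↦ ENNReal.mul_lt_top (by simp)
    (ENNReal.sum_lt_top.2 fun c _ ↦ by simp [enorm_lt_top])).ne

/-- The frequency `k ∈ ℤⁿ` as a vector of `ℝⁿ`. -/
def freqVector (k : Fin n → ℤ) : EuclideanSpace ℝ (Fin n) := WithLp.toLp 2 fun i ↦ (k i : ℝ)

theorem isSolenoidal_waveField (e : Bool) {k : Fin n → ℤ} (hk : k ≠ 0)
    {v : EuclideanSpace ℝ (Fin n)} (hv : inner ℝ (freqVector k) v = 0) :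
    IsSolenoidal (waveField e k v) := by
  refine ⟨isMeanZero_waveField e hk v, fun l ↦ ?_⟩
  have hv' : ∑ c, (k c : ℂ) * (v c : ℂ) = 0 := by
    rw [PiLp.inner_apply] at hv
    simpa [freqVector, mul_comm] using congrArg (fun r : ℝ ↦ (r : ℂ)) hv
  simp only [fieldCoeff_waveField, ← mul_assoc, ← Finset.sum_mul]
  rcases eq_or_ne l k with rfl | h
  · rw [hv', zero_mul]
  rcases eq_or_ne l (-k) with rfl | h'
  · simp only [Pi.neg_apply, Int.cast_neg, neg_mul, Finset.sum_neg_distrib, hv', neg_zero,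
      zero_mul]
  · rw [waveCoeff_eq_zero e h h', mul_zero]

theorem IsSolenoidal.inner_waveField_freqVector {f : L2Field n n} (hf : IsSolenoidal f) (e : Bool)
    (k : Fin n → ℤ) : inner ℝ f (waveField e k (freqVector k)) = 0 := by
  have hsum : ∀ e, inner ℝ f (waveField e k (freqVector k)) =
      ∑ c, (k c : ℝ) * inner ℝ f (waveField e k (EuclideanSpace.single c (1 : ℝ))) := fun e ↦ by
    rw [linearMap_eq_sum_single, inner_sum]
    simp only [real_inner_smul_right, freqVector]
  have hpi : ((2 * Real.pi : ℂ) ^ n)⁻¹ ≠ 0 := by simp [Real.pi_ne_zero]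
  have hdiv : ((inner ℝ f (waveField true k (freqVector k)) : ℝ) : ℂ) -
      (inner ℝ f (waveField false k (freqVector k)) : ℝ) * Complex.I = 0 := by
    refine (mul_eq_zero.1 (Eq.trans ?_ (hf.2 k))).resolve_left hpi
    simp only [hsum, fieldCoeff_eq_inner, mul_left_comm (Int.cast _ : ℂ)]
    push_cast
    rw [← Finset.mul_sum, Finset.sum_mul, ← Finset.sum_sub_distrib]
    simp only [mul_sub, mul_assoc]
  cases e
  · simpa using congrArg Complex.im hdiv
  · simpa using congrArg Complex.re hdiv

/-- The space of the fields satisfying `V` consists of fields of mean zero and contains, for every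
frequency `k ≠ 0`, plane waves which recover the `k`-th Fourier coefficients of its members; their
polarizations are the projections of the coordinate vectors when `V` is solenoidality. -/
structure IsWaveTested (V : L2Field n d → Prop) : Prop where
  isMeanZero : ∀ {f}, V f → IsMeanZero f
  exists_polarization : ∀ (e : Bool) {k : Fin n → ℤ} (_ : k ≠ 0) (c : Fin d),
    ∃ v : EuclideanSpace ℝ (Fin d), ‖v‖ ≤ 1 ∧ V (waveField e k v) ∧
      ∀ f, V f → inner ℝ f (waveField e k v) =
        inner ℝ f (waveField e k (EuclideanSpace.single c (1 : ℝ)))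

theorem isWaveTested_isMeanZero : IsWaveTested (IsMeanZero (n := n) (d := d)) where
  isMeanZero hf := hf
  exists_polarization e _ hk c :=
    ⟨EuclideanSpace.single c 1, by simp, isMeanZero_waveField e hk _, fun _ _ ↦ rfl⟩

theorem isWaveTested_isSolenoidal : IsWaveTested (IsSolenoidal (n := n)) where
  isMeanZero hf := hf.1
  exists_polarization e k hk c := by
    set u : EuclideanSpace ℝ (Fin n) := EuclideanSpace.single c 1
    refine ⟨(ℝ ∙ freqVector k)ᗮ.starProjection u, ?_, isSolenoidal_waveField e hk ?_, ?_⟩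
    · exact (Submodule.norm_starProjection_apply_le _ u).trans_eq (by simp [u])
    · exact Submodule.mem_orthogonal_singleton_iff_inner_right.1
        (Submodule.starProjection_apply_mem _ u)
    · intro f hf
      obtain ⟨r, hr⟩ := Submodule.mem_span_singleton.1
        (Submodule.starProjection_apply_mem (ℝ ∙ freqVector k) u)
      rw [Submodule.starProjection_orthogonal_val, ← hr, map_sub, map_smul, inner_sub_right,
        real_inner_smul_right, hf.inner_waveField_freqVector, mul_zero, sub_zero]

end Fourier

/-! ### Real Fourier modes of fields of mean zero -/

section Modes

variable {n d : ℕ}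

/-- The index set of the real Fourier modes `cos (k · x) e_c` and `sin (k · x) e_c`, `k ≠ 0`; the
Boolean is that of `waveField`. -/
abbrev Mode (n d : ℕ) : Type := {k : Fin n → ℤ // k ≠ 0} × Fin d × Bool

/-- The real Fourier mode with index `i`. -/
def modeField (i : Mode n d) : L2Field n d := waveField i.2.2 i.1 (EuclideanSpace.single i.2.1 1)

/-- The weight of `⟨f, modeField i⟩ ^ 2` in `‖f‖²` in `Ḣ^s`; the factor `(2π)⁻ⁿ` normalizes the
modes. -/
def modeWeight (s : ℝ) (i : Mode n d) : ℝ≥0∞ :=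
  ENNReal.ofReal (((2 * Real.pi) ^ n)⁻¹ * fracSymbol s i.1.1)

theorem one_le_sum_sq {k : Fin n → ℤ} (hk : k ≠ 0) : 1 ≤ ∑ i, (k i : ℝ) ^ 2 := by
  obtain ⟨i, hi⟩ := Function.ne_iff.mp hk
  have h1 : (1 : ℝ) ≤ (k i : ℝ) ^ 2 := by
    exact_mod_cast Int.add_one_le_iff.2 (sq_pos_of_ne_zero hi)
  exact h1.trans (Finset.single_le_sum (f := fun i ↦ (k i : ℝ) ^ 2) (fun _ _ ↦ sq_nonneg _)
    (Finset.mem_univ i))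

theorem fracSymbol_nonneg (s : ℝ) (k : Fin n → ℤ) : 0 ≤ fracSymbol s k :=
  Real.rpow_nonneg (Finset.sum_nonneg fun _ _ ↦ sq_nonneg _) s

theorem fracSymbol_pos (s : ℝ) {k : Fin n → ℤ} (hk : k ≠ 0) : 0 < fracSymbol s k :=
  Real.rpow_pos_of_pos (one_pos.trans_le (one_le_sum_sq hk)) s

theorem modeWeight_mul_ofReal_rpow_sq_le {s s₀ lam γ : ℝ} (h : s - 2 * γ * lam ≤ s₀)
    (i : Mode n d) :
    modeWeight s i * ENNReal.ofReal (fracSymbol lam i.1.1 ^ (-γ)) ^ 2 ≤ modeWeight s₀ i := by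
  have hk := one_le_sum_sq i.1.2
  have hk0 := one_pos.trans_le hk
  rw [modeWeight, modeWeight, ← ENNReal.ofReal_pow (Real.rpow_nonneg (fracSymbol_nonneg _ _) _),
    ← ENNReal.ofReal_mul (mul_nonneg (by positivity) (fracSymbol_nonneg _ _)), mul_assoc]
  refine ENNReal.ofReal_le_ofReal (mul_le_mul_of_nonneg_left ?_ (by positivity))
  rw [fracSymbol, fracSymbol, ← Real.rpow_mul hk0.le, ← Real.rpow_mul_natCast hk0.le,
    ← Real.rpow_add hk0]
  exact Real.rpow_le_rpow_of_exponent_le hk (by push_cast; linarith)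

theorem modeWeight_ne_top (s : ℝ) (i : Mode n d) : modeWeight s i ≠ ∞ := ENNReal.ofReal_ne_top

theorem tsum_mode (g : Mode n d → ℝ≥0∞) :
    ∑' i, g i = ∑' k, ∑ c, (g (k, c, true) + g (k, c, false)) := by
  rw [ENNReal.tsum_prod']
  simp only [tsum_fintype, Fintype.sum_prod_type, Fintype.sum_bool]

theorem hdotNorm_eq_weightedNorm {f : L2Field n d} (hf : IsMeanZero f) (s : ℝ) :
    hdotNorm s f = weightedNorm (modeWeight s) fun i ↦ ‖inner ℝ f (modeField i)‖ₑ := by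
  have hsupp : (Function.support fun k : Fin n → ℤ ↦ ENNReal.ofReal (fracSymbol s k) *
      ∑ c, ‖fieldCoeff f k c‖ₑ ^ 2) ⊆ {k | k ≠ 0} := by
    rintro k hk rfl
    exact hk (by simp [hf _])
  have hpi : (2 * Real.pi) ^ n * ((2 * Real.pi) ^ n)⁻¹ ^ 2 = ((2 * Real.pi) ^ n)⁻¹ := by
    field_simp
  rw [hdotNorm, weightedNorm, tsum_mode, ← tsum_subtype_eq_of_support_subset hsupp,
    ← ENNReal.tsum_mul_left]
  congr 1
  refine tsum_congr fun k ↦ ?_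
  simp only [enorm_fieldCoeff_sq, ← Finset.mul_sum, modeWeight, ← mul_add, modeField]
  rw [← mul_assoc, ← mul_assoc, mul_right_comm, ← ENNReal.ofReal_mul (by positivity),
    mul_right_comm, ← ENNReal.ofReal_mul' (by positivity), mul_right_comm, hpi]

theorem IsMeanZero.sub {f g : L2Field n d} (hf : IsMeanZero f) (hg : IsMeanZero g) :
    IsMeanZero (f - g) := fun c ↦ by
  have h := (hf c).trans (hg c).symm
  rw [fieldCoeff_eq_inner, fieldCoeff_eq_inner] at h
  simp only [fieldCoeff_eq_inner, inner_sub_left]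
  push_cast
  linear_combination h

end Modes

/-! ### The noise and the solution in Fourier modes -/

section Covariance

variable {U : Type*} [NormedAddCommGroup U] [InnerProductSpace ℝ U] [CompleteSpace U] {n d : ℕ}

theorem inner_covOp (G : U →L[ℝ] L2Field n d) (φ : L2Field n d) :
    inner ℝ (covOp G φ) φ = ‖ContinuousLinearMap.adjoint G φ‖ ^ 2 := by
  rw [covOp, ContinuousLinearMap.comp_apply, ← ContinuousLinearMap.adjoint_inner_right,
    real_inner_self_eq_norm_sq]

/-- The sum over `c` of the variances `⟨G G* φ, φ⟩` of the noise in the modes `φ` given by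
`waveField e k e_c`. -/
def freqVariance (G : U →L[ℝ] L2Field n d) (e : Bool) (k : Fin n → ℤ) : ℝ≥0 :=
  ∑ c, ‖ContinuousLinearMap.adjoint G (waveField e k (EuclideanSpace.single c 1))‖₊ ^ 2

theorem toNNReal_inner_covOp_waveField_le (G : U →L[ℝ] L2Field n d) (e : Bool) (k : Fin n → ℤ)
    {v : EuclideanSpace ℝ (Fin d)} (hv : ‖v‖ ≤ 1) :
    (inner ℝ (covOp G (waveField e k v)) (waveField e k v)).toNNReal ≤ freqVariance G e k := by
  rw [Real.toNNReal_le_iff_le_coe, inner_covOp, freqVariance]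
  push_cast
  refine (norm_linearMap_sq_le ((ContinuousLinearMap.adjoint G).toLinearMap ∘ₗ waveField e k)
    v).trans (mul_le_of_le_one_left (Finset.sum_nonneg fun _ _ ↦ sq_nonneg _) ?_)
  exact pow_le_one₀ (norm_nonneg v) hv

theorem traceFracLaplacian_covOp (s : ℝ) (G : U →L[ℝ] L2Field n d) :
    traceFracLaplacian s (covOp G) = ∑' k : Fin n → ℤ,
      ENNReal.ofReal (((2 * Real.pi) ^ n)⁻¹ * fracSymbol s k) *
        (freqVariance G true k + freqVariance G false k) := by
  refine tsum_congr fun k ↦ ?_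
  have hw : 0 ≤ ((2 * Real.pi) ^ n)⁻¹ * fracSymbol s k :=
    mul_nonneg (by positivity) (fracSymbol_nonneg s k)
  simp only [freqVariance, ← ENNReal.coe_add, ← Finset.sum_add_distrib,
    ENNReal.ofNNReal_finsetSum, Finset.mul_sum]
  refine Finset.sum_congr rfl fun c _ ↦ ?_
  rw [inner_covOp, inner_covOp, cosField_eq_waveField, sinField_eq_waveField, ← mul_assoc,
    mul_comm (fracSymbol s k), ENNReal.ofReal_mul hw, ← ENNReal.ofReal_coe_nnreal]
  push_cast
  rfl

theorem tsum_modeWeight_mul_freqVariance_le (s : ℝ) (G : U →L[ℝ] L2Field n d) :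
    ∑' i : Mode n d, modeWeight s i * freqVariance G i.2.2 i.1 ≤
      d * traceFracLaplacian s (covOp G) := by
  rw [tsum_mode, traceFracLaplacian_covOp, ← ENNReal.tsum_mul_left]
  refine le_trans (le_of_eq (tsum_congr fun k ↦ ?_))
    (ENNReal.tsum_comp_le_tsum_of_injective Subtype.val_injective _)
  simp [modeWeight, mul_add]

end Covariance

section Solution

variable {Ω : Type*} [MeasurableSpace Ω] {P : Measure Ω} {n d : ℕ} {V : L2Field n d → Prop}
  {lam : ℝ} {B z : ℝ≥0 → Ω → L2Field n d}

theorem IsWienerProcess.isGaussianDriver_inner {Q : L2Field n d →L[ℝ] L2Field n d}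
    (hB : IsWienerProcess P Q B) (φ : L2Field n d) :
    IsGaussianDriver P (inner ℝ (Q φ) φ).toNNReal fun t ω ↦ inner ℝ (B t ω) φ where
  aemeasurable t :=
    (show Continuous fun f : L2Field n d ↦ inner ℝ f φ by fun_prop).measurable.comp_aemeasurable
      (hB.measurable t)
  zero := hB.zero.mono fun ω hω ↦ by rw [hω, inner_zero_left]
  continuous := hB.continuous.mono fun ω hω ↦ hω.inner continuous_const
  map_sub_eq s t hst := by
    simp only [← inner_sub_left]
    exact hB.gaussian s t hst φ

theorem IsWeakSolution.inner_eq_ouPath (hz : IsWeakSolution P V lam B z)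
    (hB : ∀ᵐ ω ∂P, Continuous fun t ↦ B t ω) (hB0 : ∀ᵐ ω ∂P, B 0 ω = 0) {φ : L2Field n d}
    (hφV : V φ) (hφ : IsSmoothField φ) {a : ℝ} (ha : 0 < a) (hφa : IsFracLaplacian lam φ (a • φ)) :
    ∀ᵐ ω ∂P, ∀ t, inner ℝ (z t ω) φ = ouPath a (fun s ↦ inner ℝ (B s ω) φ) t := by
  filter_upwards [hz.init, hB, hB0, hz.weak φ (a • φ) hφV hφ hφa] with ω hz0 hc h0 hweak
  simp only [real_inner_smul_right, intervalIntegral.integral_const_mul, hz0, inner_zero_left,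
    sub_zero] at hweak
  refine eq_ouPath (X := fun t ↦ inner ℝ (z t ω) φ) ha (hc.inner continuous_const)
    (by rw [h0, inner_zero_left]) fun t ↦ ⟨?_, (hweak t).2⟩
  simpa only [inv_mul_cancel_left₀ ha.ne'] using (hweak t).1.const_mul a⁻¹

/-- In Fourier modes, `z` is almost surely the family of the Ornstein–Uhlenbeck paths with rates
`|k|^{2 lam}` which are driven by the scalar Wiener processes `β i`, of variances `v i`. -/
structure IsModeDriver (P : Measure Ω) (lam : ℝ) (v : Mode n d → ℝ≥0) (β : Mode n d → ℝ≥0 → Ω → ℝ)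
    (z : ℝ≥0 → Ω → L2Field n d) : Prop where
  isGaussianDriver : ∀ i, IsGaussianDriver P (v i) (β i)
  isMeanZero : ∀ᵐ ω ∂P, ∀ t, IsMeanZero (z t ω)
  inner_modeField : ∀ᵐ ω ∂P, ∀ i t,
    inner ℝ (z t ω) (modeField i) = ouPath (fracSymbol lam i.1.1) (fun s ↦ β i s ω) t

theorem IsWeakSolution.exists_isModeDriver {U : Type*} [NormedAddCommGroup U]
    [InnerProductSpace ℝ U] [CompleteSpace U] {G : U →L[ℝ] L2Field n d} (hV : IsWaveTested V)
    (hB : IsWienerProcess P (covOp G) B) (hz : IsWeakSolution P V lam B z) :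
    ∃ v β, (∀ i, v i ≤ freqVariance G i.2.2 i.1) ∧ IsModeDriver P lam v β z := by
  choose u hu_norm hu_mem hu_inner using
    fun i : Mode n d ↦ hV.exists_polarization i.2.2 i.1.2 i.2.1
  refine ⟨_, _, fun i ↦ toNNReal_inner_covOp_waveField_le G i.2.2 i.1 (hu_norm i),
    fun i ↦ hB.isGaussianDriver_inner _, hz.mem.mono fun ω hω t ↦ hV.isMeanZero (hω t), ?_⟩
  refine ae_all_iff.2 fun i ↦ ?_
  filter_upwards [hz.mem, hz.inner_eq_ouPath hB.continuous hB.zero (hu_mem i)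
    (isSmoothField_waveField _ _ _) (fracSymbol_pos lam i.1.2)
    (isFracLaplacian_waveField lam _ _ _)] with ω hmem hω t
  rw [← hω t, hu_inner i _ (hmem t), modeField]

end Solution

section Regularity

variable {Ω : Type*} [MeasurableSpace Ω] {P : Measure Ω} {n d : ℕ} {lam s s₀ γ : ℝ}
  {v : Mode n d → ℝ≥0} {β : Mode n d → ℝ≥0 → Ω → ℝ} {z : ℝ≥0 → Ω → L2Field n d} {T : ℝ≥0}

theorem weightedNorm_modeWeight_lt_top (hs : s - 2 * γ * lam ≤ s₀)
    (hv : ∑' i, modeWeight s₀ i * v i < ∞) :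
    weightedNorm (modeWeight s) (fun i ↦
      ENNReal.ofReal (fracSymbol lam i.1.1 ^ (-γ)) * (v i : ℝ≥0∞) ^ (1 / 2 : ℝ)) < ∞ := by
  refine weightedNorm_lt_top_iff.2 ((ENNReal.tsum_le_tsum fun i ↦ ?_).trans_lt hv)
  have hsq : ((v i : ℝ≥0∞) ^ (1 / 2 : ℝ)) ^ 2 = v i := by
    rw [← ENNReal.rpow_mul_natCast]
    norm_num
  rw [mul_pow, hsq, ← mul_assoc]
  exact mul_le_mul_left (modeWeight_mul_ofReal_rpow_sq_le hs i) _

theorem exists_exponent_lt_half (hs : s < s₀ + lam) :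
    ∃ γ : ℝ, 0 < γ ∧ γ < 1 / 2 ∧ s - 2 * γ * lam ≤ s₀ := by
  have hlim : Tendsto (fun γ : ℝ ↦ s - 2 * γ * lam) (𝓝[<] (1 / 2)) (𝓝 (s - lam)) := by
    refine (Continuous.tendsto' (by fun_prop) _ _ ?_).mono_left nhdsWithin_le_nhds
    ring
  obtain ⟨γ, hγs, hγ0, hγ⟩ := ((hlim.eventually_lt_const (sub_lt_iff_lt_add.2 hs)).and
    (Ioo_mem_nhdsLT (by norm_num : (0 : ℝ) < 1 / 2))).exists
  exact ⟨γ, hγ0, hγ, hγs.le⟩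

namespace IsModeDriver

theorem hdotNorm_eq (h : IsModeDriver P lam v β z) (s : ℝ) :
    ∀ᵐ ω ∂P, ∀ t, hdotNorm s (z t ω) = weightedNorm (modeWeight s) fun i ↦
      ‖ouPath (fracSymbol lam i.1.1) (fun s ↦ β i s ω) t‖ₑ := by
  filter_upwards [h.isMeanZero, h.inner_modeField] with ω hmean hω t
  simp only [hdotNorm_eq_weightedNorm (hmean t), hω]

theorem hdotNorm_sub_eq (h : IsModeDriver P lam v β z) (s : ℝ) :
    ∀ᵐ ω ∂P, ∀ t r, hdotNorm s (z t ω - z r ω) = weightedNorm (modeWeight s) fun i ↦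
      edist (ouPath (fracSymbol lam i.1.1) (fun s ↦ β i s ω) t)
        (ouPath (fracSymbol lam i.1.1) (fun s ↦ β i s ω) r) := by
  filter_upwards [h.isMeanZero, h.inner_modeField] with ω hmean hω t r
  simp only [hdotNorm_eq_weightedNorm ((hmean t).sub (hmean r)), inner_sub_left, hω,
    edist_eq_enorm_sub]

theorem hasAllMoments_supHdotNorm [IsFiniteMeasure P] (h : IsModeDriver P lam v β z)
    (hv : ∑' i, modeWeight s₀ i * v i < ∞) (hs : s < s₀ + lam) (hT : 0 < T) :
    HasAllMoments P fun ω ↦ supHdotNorm T s fun t ↦ z t ω := by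
  obtain ⟨γ, hγ0, hγ, hγs⟩ := exists_exponent_lt_half hs
  refine (hasAllMoments_iSup_weightedNorm_ouPath h.isGaussianDriver
    (modeWeight_ne_top s) (fun i ↦ fracSymbol_pos lam i.1.2) hγ0 hγ hT
    (weightedNorm_modeWeight_lt_top hγs hv)).congr ?_
  filter_upwards [h.hdotNorm_eq s] with ω hω
  simp only [supHdotNorm, hω]

theorem hasAllMoments_holderHdotNorm [IsFiniteMeasure P] (h : IsModeDriver P lam v β z)
    (hv : ∑' i, modeWeight s₀ i * v i < ∞) (hs : s ≤ s₀) (hs' : s < s₀ + lam) (hγ0 : 0 < γ)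
    (hγ : γ < 1 / 2) (hT : 0 < T) :
    HasAllMoments P fun ω ↦ holderHdotNorm T γ s fun t ↦ z t ω := by
  have hfin : weightedNorm (modeWeight s) (fun i ↦ (v i : ℝ≥0∞) ^ (1 / 2 : ℝ)) < ∞ := by
    simpa using weightedNorm_modeWeight_lt_top (γ := 0) (lam := lam) (by linarith) hv
  refine (h.hasAllMoments_supHdotNorm hv hs' hT).add
    ((hasAllMoments_iSup_weightedNorm_edist_ouPath_div h.isGaussianDriver
      (modeWeight_ne_top s) (fun i ↦ fracSymbol_pos lam i.1.2) hγ0 hγ hT hfin).congr ?_)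
  filter_upwards [h.hdotNorm_sub_eq s] with ω hω
  simp only [hω]

theorem ae_isContinuousHdot [IsFiniteMeasure P] (h : IsModeDriver P lam v β z)
    (hv : ∑' i, modeWeight s₀ i * v i < ∞) (hs : s < s₀ + lam) (hT : 0 < T) :
    ∀ᵐ ω ∂P, IsContinuousHdot T s fun t ↦ z t ω := by
  obtain ⟨γ, hγ0, hγ, hγs⟩ := exists_exponent_lt_half hs
  have hsup := h.hasAllMoments_supHdotNorm hv hs hT
  have hfin : ∫⁻ ω, supHdotNorm T s (fun t ↦ z t ω) ∂P < ∞ := by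
    simpa only [pow_one] using hsup.lintegral_pow_lt_top 1
  filter_upwards [ae_lt_top' hsup.aemeasurable hfin.ne, h.hdotNorm_sub_eq s,
    ae_tendsto_weightedNorm_edist_ouPath h.isGaussianDriver (modeWeight_ne_top s)
      (fun i ↦ fracSymbol_pos lam i.1.2) hγ0 hγ hT (weightedNorm_modeWeight_lt_top hγs hv)]
    with ω hlt hsub hlim t ht
  refine ⟨(le_iSup₂ (f := fun t (_ : t ∈ Set.Iic T) ↦ hdotNorm s (z t ω)) t ht).trans_lt hlt, ?_⟩
  simpa only [hsub] using hlim t ht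

end IsModeDriver

end Regularity

theorem proposition4p4_general {Ω : Type*} [MeasurableSpace Ω] {P : Measure Ω} [IsFiniteMeasure P]
    {U : Type*} [NormedAddCommGroup U] [InnerProductSpace ℝ U] [CompleteSpace U] {n d : ℕ}
    {V : L2Field n d → Prop} (hV : IsWaveTested V) {σ lam s₀ : ℝ} (hs : (n + σ) / 2 ≤ s₀)
    (hs' : (2 + n + σ) / 2 < s₀ + lam) {G : U →L[ℝ] L2Field n d}
    (hG : traceFracLaplacian s₀ (covOp G) < ∞) {B z : ℝ≥0 → Ω → L2Field n d}
    (hB : IsWienerProcess P (covOp G) B) (hz : IsWeakSolution P V lam B z) :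
    HasRegularityMoments P σ z := by
  intro δ hδ0 hδ T hT l
  obtain ⟨v, β, hvG, h⟩ := hz.exists_isModeDriver hV hB
  have hv : ∑' i, modeWeight s₀ i * v i < ∞ :=
    calc ∑' i, modeWeight s₀ i * v i
        ≤ ∑' i : Mode n d, modeWeight s₀ i * freqVariance G i.2.2 i.1 := by
          gcongr with i
          exact hvG i
      _ ≤ d * traceFracLaplacian s₀ (covOp G) := tsum_modeWeight_mul_freqVariance_le s₀ G
      _ < ∞ := ENNReal.mul_lt_top (by simp) hG
  have hsup := h.hasAllMoments_supHdotNorm hv hs' hT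
  have hhol : HasAllMoments P fun ω ↦ holderHdotNorm T (1 / 2 - δ) ((n + σ) / 2) fun t ↦ z t ω :=
    h.hasAllMoments_holderHdotNorm hv hs (by linarith) (by linarith) (by linarith) hT
  refine ⟨h.ae_isContinuousHdot hv hs' hT, hsup.aemeasurable, hhol.aemeasurable, ?_⟩
  rw [lintegral_add_left' (hsup.aemeasurable.pow_const l)]
  exact ENNReal.add_lt_top.2 ⟨hsup.lintegral_pow_lt_top l, hhol.lintegral_pow_lt_top l⟩

end

theorem proposition4p4 {Ω : Type*} [MeasurableSpace Ω] (P : Measure Ω) [IsProbabilityMeasure P]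
    {U : Type*} [NormedAddCommGroup U] [InnerProductSpace ℝ U] [CompleteSpace U]
    {U₁ : Type*} [NormedAddCommGroup U₁] [InnerProductSpace ℝ U₁] [CompleteSpace U₁]
    {U₂ : Type*} [NormedAddCommGroup U₂] [InnerProductSpace ℝ U₂] [CompleteSpace U₂]
    (n : ℕ) (hn : n = 2 ∨ n = 3) (σ : ℝ) (hσ : 0 < σ) :
    -- the equation with pressure
    (∀ (lam : ℝ) (G : U →L[ℝ] L2Field n n) (B z : ℝ≥0 → Ω → L2Field n n),
      0 < lam → lam < 1 / 2 + (n : ℝ) / 4 → (∀ u, IsMeanZero (G u)) →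
      traceFracLaplacian (max ((n : ℝ) / 2 + 2 * σ) (((n : ℝ) + 2) / 2 - lam + 2 * σ))
        (covOp G) < ∞ →
      IsWienerProcess P (covOp G) B → IsStokesSolution P lam B z →
      HasRegularityMoments P σ z) ∧
    -- the equation without pressure
    (∀ (d : ℕ) (lam : ℝ) (G : U →L[ℝ] L2Field n d) (B z : ℝ≥0 → Ω → L2Field n d),
      0 < lam → lam < 1 / 2 + (n : ℝ) / 4 → (∀ u, IsMeanZero (G u)) →
      traceFracLaplacian (max ((n : ℝ) / 2 + 2 * σ) (((n : ℝ) + 2) / 2 - lam + 2 * σ))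
        (covOp G) < ∞ →
      IsWienerProcess P (covOp G) B → IsHeatSolution P lam B z →
      HasRegularityMoments P σ z) ∧
    -- the linear parts of the velocity and of the temperature equation
    (∀ (m : ℝ) (G₁ : U₁ →L[ℝ] L2Field n n) (G₂ : U₂ →L[ℝ] L2Field n 1)
      (B₁ z₁ : ℝ≥0 → Ω → L2Field n n) (B₂ z₂ : ℝ≥0 → Ω → L2Field n 1),
      (n = 2 → 0 < m ∧ m < 1) → (n = 3 → 13 / 20 < m ∧ m < 5 / 4) →
      (∀ u, IsSolenoidal (G₁ u)) → (∀ u, IsMeanZero (G₂ u)) →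
      traceFracLaplacian (max ((n : ℝ) / 2 + 2 * σ) (((n : ℝ) + 2) / 2 - m + 2 * σ))
        (covOp G₁) < ∞ →
      traceFracLaplacian ((n : ℝ) / 2 + 2 * σ) (covOp G₂) < ∞ →
      IsWienerProcess P (covOp G₁) B₁ → IsWienerProcess P (covOp G₂) B₂ →
      IsStokesSolution P m B₁ z₁ → IsHeatSolution P 1 B₂ z₂ →
      HasRegularityMoments P σ z₁ ∧ HasRegularityMoments P σ z₂) := by
  have hs : (n + σ) / 2 ≤ n / 2 + 2 * σ := by linarith
  have hs_max (lam : ℝ) : (n + σ) / 2 ≤ max (n / 2 + 2 * σ) ((n + 2) / 2 - lam + 2 * σ) :=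
    hs.trans (le_max_left _ _)
  have hs'_max (lam : ℝ) :
      (2 + n + σ) / 2 < max (n / 2 + 2 * σ) ((n + 2) / 2 - lam + 2 * σ) + lam := by
    linarith [le_max_right (n / 2 + 2 * σ) ((n + 2) / 2 - lam + 2 * σ)]
  refine ⟨fun lam G B z _ _ _ hG hB hz ↦ ?_, fun d lam G B z _ _ _ hG hB hz ↦ ?_,
    fun m G₁ G₂ B₁ z₁ B₂ z₂ _ _ _ _ hG₁ hG₂ hB₁ hB₂ hz₁ hz₂ ↦ ⟨?_, ?_⟩⟩
  · exact proposition4p4_general isWaveTested_isSolenoidal (hs_max lam) (hs'_max lam) hG hB hz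
  · exact proposition4p4_general isWaveTested_isMeanZero (hs_max lam) (hs'_max lam) hG hB hz
  · exact proposition4p4_general isWaveTested_isSolenoidal (hs_max m) (hs'_max m) hG₁ hB₁ hz₁
  · exact proposition4p4_general isWaveTested_isMeanZero hs (by linarith) hG₂ hB₂ hz₂
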